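/- Let $\alpha_1<\alpha_2<\dots<\alpha_n$ be real numbers attached to elements $v_1,\dots,v_n$. For a non-empty set $B$ of elements put $\mathrm{range}(B)=\max_{v_i\in B}\alpha_i-\min_{v_i\in B}\alpha_i$. A $k$-partition is a partition of $\{v_1,\dots,v_n\}$ into $k$ disjoint non-empty sets $S_1,\dots,S_k$, and the problem min max $k$ range asks for a $k$-partition that minimises $\max_{j}\mathrm{range}(S_j)$. Running times are counted in the real random access machine model: arithmetic operations and comparisons on real numbers, addition, subtraction, halving and comparison of integers, memory accesses and assignments cost one step each. 1. (Blocks) If $1\le k\le n$, some optimal $k$-partition consists of consecutive blocks: there are $0=i_0<i_1<\dots<i_k=n$ with $S_j=\{v_{i_{j-1}+1},\dots,v_{i_j}\}$. 2. (Feasibility check) Consider the greedy scan that, given $z\ge 0$, starts an interval at $\alpha_1$, extends it to the largest $\alpha_j$ that exceeds the first value of the interval by at most $z$, starts the next interval at $\alpha_{j+1}$, and so on, until $k$ intervals are formed or $\alpha_n$ is covered; it answers "feasible" if and only if $\alpha_n$ is covered. For $1\le k\le n$ it takes $O(n)$ steps, and it answers "feasible" if and only if there is a $k$-partition with $\max_j\mathrm{range}(S_j)\le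 z$. 3. (Selection) Let $N=\binom n2$ and let $d_1\ge d_2\ge\dots\ge d_N$ be the differences $\alpha_q-\alpha_p$, $1\le p<q\le n$, listed with multiplicity in non-increasing order; these are the lengths of the simple paths in the path graph on $1,\dots,n$ whose edges $[i,i+1]$ have weights $\alpha_{i+1}-\alpha_i$. There is a program that, for all $n\ge 2$ and $1\le r\le N$, computes $d_r$ from $(\alpha_1,\dots,\alpha_n)$ and $r$ in $O(n\log^2 n)$ steps. 4. (Algorithm) Let $M$ be any program as in 3. Consider the following algorithm with input $n$, $k$ and the array $\alpha_1<\dots<\alpha_n$. Set $a_{\min}:=1$, $a_{\max}:=N$. While $a_{\min}<a_{\max}$: let $m:=\lfloor (a_{\min}+a_{\max})/2\rfloor$; by a call to $M$ let $z$ be the $m$-th smallest difference $d_{N+1-m}$; run the scan of 2; if $z$ is feasible put $a_{\max}:=m$, otherwise $a_{\min}:=m+1$. Finally let $z^*:=d_{N+1-a_{\min}}$ by a call to $M$, and output $z^*$ and the clusters $S_1^*,\dots,S_k^*$ formed by the greedy scan with value $z^*$, in which the $j$-th interval is also ended as soon as exactly $k-j$ elements remain. For all $1\le k<n$ this algorithm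 stops after $O(n\log^3 n)$ steps, $(S_1^*,\dots,S_k^*)$ is an optimal $k$-partition into consecutive blocks, and $z^*$ is its value $\max_j\mathrm{range}(S_j^*)$. The constants in the $O(\cdot)$ are absolute, except that in 4 the constant may depend on the program $M$; in particular they do not depend on $n$, $k$, $z$, $r$ or the $\alpha_i$. -/

import Mathlib

namespace RangeClustering

/-! ### The clustering problem

The elements are `v_i`, `i : Fin n`, with scalars `α i`. -/

/-- A `k`-partition of the `n` elements: `k` disjoint non-empty sets that cover everything. -/
structure KPartition (n k : ℕ) where
  S : Fin k → Finset (Fin n)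
  nonempty : ∀ j, (S j).Nonempty
  disjoint : ∀ j j', j ≠ j' → Disjoint (S j) (S j')
  cover : ∀ i, ∃ j, i ∈ S j

/-- `range(B) = max(B) - min(B)` for a non-empty set `B` of elements. -/
noncomputable def scalarRange {n : ℕ} (α : Fin n → ℝ) (B : Finset (Fin n)) (h : B.Nonempty) : ℝ :=
  B.sup' h α - B.inf' h α

/-- The objective `max_j range(S_j)`. -/
noncomputable def KPartition.maxRange {n k : ℕ} (P : KPartition n k) (α : Fin n → ℝ) : ℝ :=
  ⨆ j, scalarRange α (P.S j) (P.nonempty j)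

/-- `P` is an optimal solution of min max `k` range. -/
def KPartition.IsOptimal {n k : ℕ} (P : KPartition n k) (α : Fin n → ℝ) : Prop :=
  ∀ Q : KPartition n k, P.maxRange α ≤ Q.maxRange α

/-- The clusters are consecutive blocks: there are break points `0 = e 0, e 1, …, e k = n` with
`S_j = {e j, …, e (j + 1) - 1}`. -/
def KPartition.IsConsecutive {n k : ℕ} (P : KPartition n k) : Prop :=
  ∃ e : ℕ → ℕ, e 0 = 0 ∧ e k = n ∧
    ∀ (j : Fin k) (i : Fin n), i ∈ P.S j ↔ e j ≤ i ∧ (i : ℕ) < e (j + 1)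

/-- The candidate values `α_q - α_p`, `p < q`, with multiplicity: the lengths of all simple paths of
the path graph on the elements whose `i`-th edge has weight `α_{i+1} - α_i`. -/
noncomputable def candidates {n : ℕ} (α : Fin n → ℝ) : Multiset ℝ :=
  ((Finset.univ : Finset (Fin n × Fin n)).filter (fun p => p.1 < p.2)).val.map
    (fun p => α p.2 - α p.1)

/-- `x = d_r`, where `d_1 ≥ d_2 ≥ …` are the candidate values in non-increasing order. -/
def IsNthLongest {n : ℕ} (α : Fin n → ℝ) (r : ℕ) (x : ℝ) : Prop :=
  1 ≤ r ∧ ((candidates α).sort (· ≥ ·))[r - 1]? = some x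

/-! ### A real random access machine

Programs act on registers and unbounded arrays that hold natural numbers (counters, indices) or real
numbers.  Every arithmetic operation, comparison, memory access and assignment costs one step.  There
is no operation that converts reals into integers, and no integer multiplication. -/

/-- Registers for natural numbers; the registers `tmp i` are free for use by a subroutine. -/
inductive NVar
  | n | k | total | aMin | aMax | m | rank | b | j | ok
  | tmp (i : ℕ)
  deriving DecidableEq

/-- Registers for reals. -/
inductive RVar
  | z | s
  | tmp (i : ℕ)
  deriving DecidableEq

/-- Arrays of natural numbers. -/
inductive NArr
  | label
  | tmp (i : ℕ)
  deriving DecidableEq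

/-- Arrays of reals. -/
inductive RArr
  | alpha
  | tmp (i : ℕ)
  deriving DecidableEq

/-- Memory contents. -/
structure State where
  nat : NVar → ℕ
  real : RVar → ℝ
  natArr : NArr → ℕ → ℕ
  realArr : RArr → ℕ → ℝ

/-- Integer expressions; `sub` is truncated subtraction, `half` is `⌊·/2⌋`. -/
inductive NExp
  | const (c : ℕ)
  | var (x : NVar)
  | get (a : NArr) (i : NExp)
  | add (e f : NExp)
  | sub (e f : NExp)
  | half (e : NExp)

/-- Real expressions. -/
inductive RExp
  | const (c : ℚ)
  | var (x : RVar)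
  | get (a : RArr) (i : NExp)
  | add (e f : RExp)
  | sub (e f : RExp)
  | mul (e f : RExp)
  | div (e f : RExp)

/-- Tests. -/
inductive BExp
  | natLe (e f : NExp)
  | natLt (e f : NExp)
  | realLe (e f : RExp)
  | realLt (e f : RExp)
  | not (p : BExp)
  | and (p q : BExp)

def NExp.eval (σ : State) : NExp → ℕ
  | .const c => c
  | .var x => σ.nat x
  | .get a i => σ.natArr a (i.eval σ)
  | .add e f => e.eval σ + f.eval σ
  | .sub e f => e.eval σ - f.eval σ
  | .half e => e.eval σ / 2

/-- The number of steps needed to evaluate the expression. -/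
def NExp.cost : NExp → ℕ
  | .const _ => 1
  | .var _ => 1
  | .get _ i => i.cost + 1
  | .add e f => e.cost + f.cost + 1
  | .sub e f => e.cost + f.cost + 1
  | .half e => e.cost + 1

noncomputable def RExp.eval (σ : State) : RExp → ℝ
  | .const c => (c : ℝ)
  | .var x => σ.real x
  | .get a i => σ.realArr a (i.eval σ)
  | .add e f => e.eval σ + f.eval σ
  | .sub e f => e.eval σ - f.eval σ
  | .mul e f => e.eval σ * f.eval σ
  | .div e f => e.eval σ / f.eval σ

def RExp.cost : RExp → ℕ
  | .const _ => 1
  | .var _ => 1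
  | .get _ i => i.cost + 1
  | .add e f => e.cost + f.cost + 1
  | .sub e f => e.cost + f.cost + 1
  | .mul e f => e.cost + f.cost + 1
  | .div e f => e.cost + f.cost + 1

def BExp.Holds (σ : State) : BExp → Prop
  | .natLe e f => e.eval σ ≤ f.eval σ
  | .natLt e f => e.eval σ < f.eval σ
  | .realLe e f => e.eval σ ≤ f.eval σ
  | .realLt e f => e.eval σ < f.eval σ
  | .not p => ¬ p.Holds σ
  | .and p q => p.Holds σ ∧ q.Holds σ

def BExp.cost : BExp → ℕ
  | .natLe e f => e.cost + f.cost + 1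
  | .natLt e f => e.cost + f.cost + 1
  | .realLe e f => e.cost + f.cost + 1
  | .realLt e f => e.cost + f.cost + 1
  | .not p => p.cost + 1
  | .and p q => p.cost + q.cost + 1

/-- Programs. -/
inductive Cmd
  | skip
  | setN (x : NVar) (e : NExp)
  | setR (x : RVar) (e : RExp)
  | putN (a : NArr) (i e : NExp)
  | putR (a : RArr) (i : NExp) (e : RExp)
  | seq (c d : Cmd)
  | cond (p : BExp) (c d : Cmd)
  | loop (p : BExp) (c : Cmd)

def State.setN (σ : State) (x : NVar) (v : ℕ) : State :=
  { σ with nat := Function.update σ.nat x v }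

def State.setR (σ : State) (x : RVar) (v : ℝ) : State :=
  { σ with real := Function.update σ.real x v }

def State.putN (σ : State) (a : NArr) (i v : ℕ) : State :=
  { σ with natArr := Function.update σ.natArr a (Function.update (σ.natArr a) i v) }

def State.putR (σ : State) (a : RArr) (i : ℕ) (v : ℝ) : State :=
  { σ with realArr := Function.update σ.realArr a (Function.update (σ.realArr a) i v) }

/-- `Exec c σ σ' t`: started in `σ`, the program `c` halts in `σ'` after exactly `t` steps. -/
inductive Exec : Cmd → State → State → ℕ → Prop
  | skip (σ : State) : Exec .skip σ σ 1
  | setN (σ : State) (x : NVar) (e : NExp) :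
      Exec (.setN x e) σ (σ.setN x (e.eval σ)) (e.cost + 1)
  | setR (σ : State) (x : RVar) (e : RExp) :
      Exec (.setR x e) σ (σ.setR x (e.eval σ)) (e.cost + 1)
  | putN (σ : State) (a : NArr) (i e : NExp) :
      Exec (.putN a i e) σ (σ.putN a (i.eval σ) (e.eval σ)) (i.cost + e.cost + 1)
  | putR (σ : State) (a : RArr) (i : NExp) (e : RExp) :
      Exec (.putR a i e) σ (σ.putR a (i.eval σ) (e.eval σ)) (i.cost + e.cost + 1)
  | seq {c d : Cmd} {σ σ₁ σ₂ : State} {t₁ t₂ : ℕ} :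
      Exec c σ σ₁ t₁ → Exec d σ₁ σ₂ t₂ → Exec (.seq c d) σ σ₂ (t₁ + t₂)
  | condTrue {p : BExp} {c d : Cmd} {σ σ' : State} {t : ℕ} :
      p.Holds σ → Exec c σ σ' t → Exec (.cond p c d) σ σ' (p.cost + 1 + t)
  | condFalse {p : BExp} {c d : Cmd} {σ σ' : State} {t : ℕ} :
      ¬ p.Holds σ → Exec d σ σ' t → Exec (.cond p c d) σ σ' (p.cost + 1 + t)
  | loopStop {p : BExp} {c : Cmd} {σ : State} :
      ¬ p.Holds σ → Exec (.loop p c) σ σ (p.cost + 1)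
  | loopStep {p : BExp} {c : Cmd} {σ σ₁ σ₂ : State} {t₁ t₂ : ℕ} :
      p.Holds σ → Exec c σ σ₁ t₁ → Exec (.loop p c) σ₁ σ₂ t₂ →
        Exec (.loop p c) σ σ₂ (p.cost + 1 + t₁ + t₂)

/-- The machine is deterministic, so final state and step count are functions of the start state. -/
theorem Exec.unique {c : Cmd} {σ σ₁ σ₂ : State} {t₁ t₂ : ℕ} (h₁ : Exec c σ σ₁ t₁)
    (h₂ : Exec c σ σ₂ t₂) : σ₁ = σ₂ ∧ t₁ = t₂ := by
  induction h₁ generalizing σ₂ t₂ with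
  | skip | setN | setR | putN | putR => cases h₂; exact ⟨rfl, rfl⟩
  | seq _ _ ih₁ ih₂ =>
    cases h₂ with
    | seq a b =>
      obtain ⟨rfl, rfl⟩ := ih₁ a
      obtain ⟨rfl, rfl⟩ := ih₂ b
      exact ⟨rfl, rfl⟩
  | condTrue hp _ ih =>
    cases h₂ with
    | condTrue _ a => obtain ⟨rfl, rfl⟩ := ih a; exact ⟨rfl, rfl⟩
    | condFalse hn _ => exact absurd hp hn
  | condFalse hn _ ih =>
    cases h₂ with
    | condTrue hp _ => exact absurd hp hn
    | condFalse _ a => obtain ⟨rfl, rfl⟩ := ih a; exact ⟨rfl, rfl⟩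
  | loopStop hn =>
    cases h₂ with
    | loopStop => exact ⟨rfl, rfl⟩
    | loopStep hp => exact absurd hp hn
  | loopStep hp _ _ ih₁ ih₂ =>
    cases h₂ with
    | loopStop hn => exact absurd hp hn
    | loopStep _ a b =>
      obtain ⟨rfl, rfl⟩ := ih₁ a
      obtain ⟨rfl, rfl⟩ := ih₂ b
      exact ⟨rfl, rfl⟩

/-- Sequential execution of a list of programs. -/
def block (l : List Cmd) : Cmd := l.foldr Cmd.seq Cmd.skip

/-- The memory holds the scalars (`alpha[i] = α_i` for `0 ≤ i < n`) and their number `n`.  All other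
memory contents are arbitrary. -/
def State.HasScalars (σ : State) {n : ℕ} (α : Fin n → ℝ) : Prop :=
  σ.nat .n = n ∧ ∀ i : Fin n, σ.realArr .alpha i = α i

/-! ### The algorithm -/

/-- The greedy feasibility check for the value in `z`:
```
b := 0;  j := 0
while b < k and j < n:
  s := alpha[j];  j := j + 1
  while j < n and alpha[j] ≤ s + z:  j := j + 1
  b := b + 1
ok := (if j < n then 0 else 1)
``` -/
def feasibilityCheck : Cmd :=
  block
    [.setN .b (.const 0),
     .setN .j (.const 0),
     .loop (.and (.natLt (.var .b) (.var .k)) (.natLt (.var .j) (.var .n))) (block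
       [.setR .s (.get .alpha (.var .j)),
        .setN .j (.add (.var .j) (.const 1)),
        .loop (.and (.natLt (.var .j) (.var .n))
            (.realLe (.get .alpha (.var .j)) (.add (.var .s) (.var .z))))
          (.setN .j (.add (.var .j) (.const 1))),
        .setN .b (.add (.var .b) (.const 1))]),
     .cond (.natLt (.var .j) (.var .n)) (.setN .ok (.const 0)) (.setN .ok (.const 1))]

/-- The same greedy scan, now writing out the clusters (`label[i] = b` means `v_i ∈ S_b`, with
`0 ≤ b < k`).  An interval is also ended when the remaining elements are just enough to make the
remaining clusters non-empty, so that exactly `k` clusters are formed: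
```
b := 0;  j := 0
while b < k:
  s := alpha[j];  label[j] := b;  j := j + 1
  while j + k ≤ n + b and alpha[j] ≤ s + z:  label[j] := b;  j := j + 1
  b := b + 1
``` -/
def writeClusters : Cmd :=
  block
    [.setN .b (.const 0),
     .setN .j (.const 0),
     .loop (.natLt (.var .b) (.var .k)) (block
       [.setR .s (.get .alpha (.var .j)),
        .putN .label (.var .j) (.var .b),
        .setN .j (.add (.var .j) (.const 1)),
        .loop (.and (.natLe (.add (.var .j) (.var .k)) (.add (.var .n) (.var .b)))
            (.realLe (.get .alpha (.var .j)) (.add (.var .s) (.var .z))))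
          (block
            [.putN .label (.var .j) (.var .b),
             .setN .j (.add (.var .j) (.const 1))]),
        .setN .b (.add (.var .b) (.const 1))])]

/-- `total := 1 + 2 + … + (n - 1) = n choose 2`. -/
def countPairs : Cmd :=
  block
    [.setN .total (.const 0),
     .setN .j (.const 1),
     .loop (.natLt (.var .j) (.var .n)) (block
       [.setN .total (.add (.var .total) (.var .j)),
        .setN .j (.add (.var .j) (.const 1))])]

/-- The algorithm for min max `k` range, with a subroutine `M` that puts the `rank`-th longest of the
candidate values `α_q - α_p` into `z`.  The `m`-th smallest of the `total = n choose 2` candidates is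
the `(total + 1 - m)`-th longest.
```
total := n choose 2;  aMin := 1;  aMax := total
while aMin < aMax:
  m := ⌊(aMin + aMax) / 2⌋
  z := m-th smallest candidate
  if z is feasible then aMax := m else aMin := m + 1
z := aMin-th smallest candidate
write out the greedy clusters for z
``` -/
def minMaxKRange (M : Cmd) : Cmd :=
  block
    [countPairs,
     .setN .aMin (.const 1),
     .setN .aMax (.var .total),
     .loop (.natLt (.var .aMin) (.var .aMax)) (block
       [.setN .m (.half (.add (.var .aMin) (.var .aMax))),
        .setN .rank (.sub (.add (.var .total) (.const 1)) (.var .m)),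
        M,
        feasibilityCheck,
        .cond (.natLt (.const 0) (.var .ok))
          (.setN .aMax (.var .m))
          (.setN .aMin (.add (.var .m) (.const 1)))]),
     .setN .rank (.sub (.add (.var .total) (.const 1)) (.var .aMin)),
     M,
     writeClusters]

/-- `σ'` agrees with `σ` outside the register `z` and the scratch memory `tmp`. -/
def State.AgreesOffScratch (σ σ' : State) : Prop :=
  (∀ x : NVar, (∀ i, x ≠ .tmp i) → σ'.nat x = σ.nat x) ∧
  (∀ x : RVar, x ≠ .z → (∀ i, x ≠ .tmp i) → σ'.real x = σ.real x) ∧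
  (∀ a : NArr, (∀ i, a ≠ .tmp i) → σ'.natArr a = σ.natArr a) ∧
  (∀ a : RArr, (∀ i, a ≠ .tmp i) → σ'.realArr a = σ.realArr a)

/-- `M` finds the `r`-th longest path of the path graph (`r` given in `rank`, result in `z`) in
`O(n log² n)` steps, for `n ≥ 2`, without disturbing the memory of its caller. -/
def IsPathSelector (M : Cmd) : Prop :=
  ∃ C : ℝ, ∀ (n : ℕ) (α : Fin n → ℝ) (r : ℕ) (σ : State),
    2 ≤ n → StrictMono α → 1 ≤ r → r ≤ n.choose 2 →
    σ.HasScalars α → σ.nat .rank = r →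
    ∃ (σ' : State) (t : ℕ), Exec M σ σ' t ∧ (t : ℝ) ≤ C * n * Real.log n ^ 2 ∧
      IsNthLongest α r (σ'.real .z) ∧ σ.AgreesOffScratch σ'

end RangeClustering

/-! Feasibility. If the greedy scan for `z` has not covered everything after `b` intervals, its `b +
1` starting values are pairwise more than `z` apart, so any partition of range at most `z` has them
in `b + 1` different clusters (`card_clusters_met`). Hence a `k`-partition of value at most `z`
forces the scan to finish within `k` intervals. Conversely, a scan that finishes can be slowed down
so that enough elements remain for the later clusters. This only shortens intervals and produces
exactly `k` non-empty blocks (`greedyPartition`). Together these give `exists_partition_iff`.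
Running the slowed scan with the value of an optimal partition turns that partition into consecutive
blocks.

Search. For `k < n` two elements share a cluster, so every objective value is a positive difference
and therefore one of the `N = n.choose 2` candidates. Feasibility is monotone in `z`, so binary
search over ranks finds the smallest feasible candidate, which is the optimum. The gap between the
two rank bounds is at least halved per round, which leaves `O(log n)` calls of the selector and of
the linear scan.

Selection. The differences form a matrix whose rows are sorted, and in each row the still possible
candidates form an index interval. A weighted median `z` of the middle elements of these intervals,
with the interval lengths as weights, has at least half of the weight in rows whose middle is `≤ z`,
and likewise for `≥ z`. Comparing the rank of `z` with `r` therefore removes half of each row in a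
family holding half of the candidates, that is, a quarter of all. The median is found by repeatedly
extracting the least key from a tournament tree, in `O(n log n)` steps. The rank of `z` is found by
a staircase scan in `O(n)` steps, and `O(log n)` rounds suffice. Ties are harmless, because
`isNthLongest_iff` describes rank `r` by the number of candidates `> x` and the number `≥ x`.

Running times. `Runs` is a total-correctness logic with step counts. Loops are handled by an
invariant and a potential (`runs_loop_frame`), and memory that a program never assigns to is
preserved for syntactic reasons (`Exec.frame`). Logarithms appear as bit lengths `Nat.size` and
become real logarithms only at the end. -/

namespace RangeClustering

/-! ### Program logic with step counts -/

/-- Started in `σ`, the program `c` halts in a state `σ'` after `t` steps with `Q σ' t`. -/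
def Runs (c : Cmd) (σ : State) (Q : State → ℕ → Prop) : Prop :=
  ∃ σ' t, Exec c σ σ' t ∧ Q σ' t

theorem Runs.mono {c : Cmd} {σ : State} {Q Q' : State → ℕ → Prop} (h : Runs c σ Q)
    (hQ : ∀ σ' t, Q σ' t → Q' σ' t) : Runs c σ Q' := by
  obtain ⟨σ', t, he, hq⟩ := h
  exact ⟨σ', t, he, hQ _ _ hq⟩

theorem runs_skip {σ : State} {Q : State → ℕ → Prop} : Runs .skip σ Q ↔ Q σ 1 := by
  constructor
  · rintro ⟨σ', t, he, hq⟩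
    cases he
    exact hq
  · exact fun h => ⟨_, _, .skip σ, h⟩

theorem runs_setN {σ : State} {x : NVar} {e : NExp} {Q : State → ℕ → Prop} :
    Runs (.setN x e) σ Q ↔ Q (σ.setN x (e.eval σ)) (e.cost + 1) := by
  constructor
  · rintro ⟨σ', t, he, hq⟩
    cases he
    exact hq
  · exact fun h => ⟨_, _, .setN σ x e, h⟩

theorem runs_setR {σ : State} {x : RVar} {e : RExp} {Q : State → ℕ → Prop} :
    Runs (.setR x e) σ Q ↔ Q (σ.setR x (e.eval σ)) (e.cost + 1) := by
  constructor
  · rintro ⟨σ', t, he, hq⟩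
    cases he
    exact hq
  · exact fun h => ⟨_, _, .setR σ x e, h⟩

theorem runs_putN {σ : State} {a : NArr} {i e : NExp} {Q : State → ℕ → Prop} :
    Runs (.putN a i e) σ Q ↔ Q (σ.putN a (i.eval σ) (e.eval σ)) (i.cost + e.cost + 1) := by
  constructor
  · rintro ⟨σ', t, he, hq⟩
    cases he
    exact hq
  · exact fun h => ⟨_, _, .putN σ a i e, h⟩

theorem runs_putR {σ : State} {a : RArr} {i : NExp} {e : RExp} {Q : State → ℕ → Prop} :
    Runs (.putR a i e) σ Q ↔ Q (σ.putR a (i.eval σ) (e.eval σ)) (i.cost + e.cost + 1) := by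
  constructor
  · rintro ⟨σ', t, he, hq⟩
    cases he
    exact hq
  · exact fun h => ⟨_, _, .putR σ a i e, h⟩

theorem runs_seq {σ : State} {c d : Cmd} {Q : State → ℕ → Prop} :
    Runs (.seq c d) σ Q ↔
      Runs c σ (fun σ₁ t₁ => Runs d σ₁ (fun σ₂ t₂ => Q σ₂ (t₁ + t₂))) := by
  constructor
  · rintro ⟨σ', t, he, hq⟩
    cases he with
    | seq h₁ h₂ => exact ⟨_, _, h₁, _, _, h₂, hq⟩
  · rintro ⟨_, _, h₁, _, _, h₂, hq⟩
    exact ⟨_, _, .seq h₁ h₂, hq⟩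

theorem runs_cond {σ : State} {p : BExp} {c d : Cmd} {Q : State → ℕ → Prop} :
    Runs (.cond p c d) σ Q ↔
      (p.Holds σ → Runs c σ (fun σ' t => Q σ' (p.cost + 1 + t))) ∧
      (¬ p.Holds σ → Runs d σ (fun σ' t => Q σ' (p.cost + 1 + t))) := by
  constructor
  · rintro ⟨σ', t, he, hq⟩
    cases he with
    | condTrue hp h => exact ⟨fun _ => ⟨_, _, h, hq⟩, fun hn => absurd hp hn⟩
    | condFalse hn h => exact ⟨fun hp => absurd hp hn, fun _ => ⟨_, _, h, hq⟩⟩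
  · rintro ⟨h₁, h₂⟩
    by_cases hp : p.Holds σ
    · obtain ⟨_, _, h, hq⟩ := h₁ hp
      exact ⟨_, _, .condTrue hp h, hq⟩
    · obtain ⟨_, _, h, hq⟩ := h₂ hp
      exact ⟨_, _, .condFalse hp h, hq⟩

/-- Amortised rule for loops: `I` is an invariant, and `Φ` a potential that pays for each pass. -/
theorem runs_loop {p : BExp} {c : Cmd} (I : State → Prop) (Φ : State → ℕ)
    (step : ∀ σ, I σ → p.Holds σ →
      Runs c σ (fun σ' t => I σ' ∧ t + (p.cost + 1) + Φ σ' ≤ Φ σ))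
    {σ : State} (h : I σ) :
    Runs (.loop p c) σ
      (fun σ' t => I σ' ∧ ¬ p.Holds σ' ∧ t + Φ σ' ≤ Φ σ + (p.cost + 1)) := by
  -- Termination comes with the bound: evaluating the test costs at least one step, so every pass
  -- strictly lowers the potential.
  induction hm : Φ σ using Nat.strong_induction_on generalizing σ with
  | _ m ih =>
    subst hm
    by_cases hp : p.Holds σ
    · obtain ⟨σ₁, t₁, he₁, hI, ht⟩ := step σ h hp
      obtain ⟨σ₂, t₂, he₂, hI₂, hp₂, ht₂⟩ := ih (Φ σ₁) (by omega) hI rfl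
      exact ⟨σ₂, _, .loopStep hp he₁ he₂, hI₂, hp₂, by omega⟩
    · exact ⟨σ, _, .loopStop hp, h, hp, by omega⟩

/-! ### Frames: memory that a program leaves unchanged -/

/-- `c` contains an assignment to the register `x`. -/
def Cmd.WritesN (x : NVar) : Cmd → Prop
  | .setN y _ => y = x
  | .seq c d => c.WritesN x ∨ d.WritesN x
  | .cond _ c d => c.WritesN x ∨ d.WritesN x
  | .loop _ c => c.WritesN x
  | _ => False

/-- `c` contains an assignment to the register `x`. -/
def Cmd.WritesR (x : RVar) : Cmd → Prop
  | .setR y _ => y = x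
  | .seq c d => c.WritesR x ∨ d.WritesR x
  | .cond _ c d => c.WritesR x ∨ d.WritesR x
  | .loop _ c => c.WritesR x
  | _ => False

/-- `c` contains an assignment to the array `a`. -/
def Cmd.WritesNArr (a : NArr) : Cmd → Prop
  | .putN b _ _ => b = a
  | .seq c d => c.WritesNArr a ∨ d.WritesNArr a
  | .cond _ c d => c.WritesNArr a ∨ d.WritesNArr a
  | .loop _ c => c.WritesNArr a
  | _ => False

/-- `c` contains an assignment to the array `a`. -/
def Cmd.WritesRArr (a : RArr) : Cmd → Prop
  | .putR b _ _ => b = a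
  | .seq c d => c.WritesRArr a ∨ d.WritesRArr a
  | .cond _ c d => c.WritesRArr a ∨ d.WritesRArr a
  | .loop _ c => c.WritesRArr a
  | _ => False

/-- `σ'` agrees with `σ` on all memory that `c` does not write to. -/
structure Frame (c : Cmd) (σ σ' : State) : Prop where
  nat : ∀ x, ¬ c.WritesN x → σ'.nat x = σ.nat x
  real : ∀ x, ¬ c.WritesR x → σ'.real x = σ.real x
  natArr : ∀ a, ¬ c.WritesNArr a → σ'.natArr a = σ.natArr a
  realArr : ∀ a, ¬ c.WritesRArr a → σ'.realArr a = σ.realArr a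

theorem Frame.refl (c : Cmd) (σ : State) : Frame c σ σ :=
  ⟨fun _ _ => rfl, fun _ _ => rfl, fun _ _ => rfl, fun _ _ => rfl⟩

theorem Frame.trans {c : Cmd} {σ σ₁ σ₂ : State} (h₁ : Frame c σ σ₁) (h₂ : Frame c σ₁ σ₂) :
    Frame c σ σ₂ :=
  ⟨fun x h => (h₂.nat x h).trans (h₁.nat x h), fun x h => (h₂.real x h).trans (h₁.real x h),
    fun x h => (h₂.natArr x h).trans (h₁.natArr x h),
    fun x h => (h₂.realArr x h).trans (h₁.realArr x h)⟩

theorem Frame.weaken {c d : Cmd} {σ σ' : State} (h : Frame c σ σ')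
    (hN : ∀ x, c.WritesN x → d.WritesN x) (hR : ∀ x, c.WritesR x → d.WritesR x)
    (hNA : ∀ x, c.WritesNArr x → d.WritesNArr x)
    (hRA : ∀ x, c.WritesRArr x → d.WritesRArr x) : Frame d σ σ' :=
  ⟨fun x hx => h.nat x (fun h' => hx (hN x h')), fun x hx => h.real x (fun h' => hx (hR x h')),
    fun x hx => h.natArr x (fun h' => hx (hNA x h')),
    fun x hx => h.realArr x (fun h' => hx (hRA x h'))⟩

/-- Only assignments change memory, and each changes a single register or array. Preservation of a
register across a subroutine thus becomes a syntactic question that `simp` can decide. -/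
theorem Exec.frame {c : Cmd} {σ σ' : State} {t : ℕ} (h : Exec c σ σ' t) : Frame c σ σ' := by
  induction h with
  | skip σ => exact Frame.refl _ _
  | setN σ x e =>
    exact ⟨fun y hy => Function.update_of_ne (fun h => hy h.symm) _ _, fun _ _ => rfl,
      fun _ _ => rfl, fun _ _ => rfl⟩
  | setR σ x e =>
    exact ⟨fun _ _ => rfl, fun y hy => Function.update_of_ne (fun h => hy h.symm) _ _,
      fun _ _ => rfl, fun _ _ => rfl⟩
  | putN σ x i e =>
    exact ⟨fun _ _ => rfl, fun _ _ => rfl,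
      fun y hy => Function.update_of_ne (fun h => hy h.symm) _ _, fun _ _ => rfl⟩
  | putR σ x i e =>
    exact ⟨fun _ _ => rfl, fun _ _ => rfl, fun _ _ => rfl,
      fun y hy => Function.update_of_ne (fun h => hy h.symm) _ _⟩
  | seq _ _ ih₁ ih₂ =>
    exact (ih₁.weaken (fun _ => Or.inl) (fun _ => Or.inl) (fun _ => Or.inl)
      (fun _ => Or.inl)).trans (ih₂.weaken (fun _ => Or.inr) (fun _ => Or.inr)
      (fun _ => Or.inr) (fun _ => Or.inr))
  | condTrue _ _ ih =>
    exact ih.weaken (fun _ => Or.inl) (fun _ => Or.inl) (fun _ => Or.inl) (fun _ => Or.inl)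
  | condFalse _ _ ih =>
    exact ih.weaken (fun _ => Or.inr) (fun _ => Or.inr) (fun _ => Or.inr) (fun _ => Or.inr)
  | loopStop _ => exact Frame.refl _ _
  | loopStep _ _ _ ih₁ ih₂ =>
    exact Frame.trans (ih₁.weaken (fun _ => id) (fun _ => id) (fun _ => id) (fun _ => id)) ih₂

theorem Runs.frame {c : Cmd} {σ : State} {Q : State → ℕ → Prop} (h : Runs c σ Q) :
    Runs c σ (fun σ' t => Frame c σ σ' ∧ Q σ' t) := by
  obtain ⟨σ', t, he, hq⟩ := h
  exact ⟨σ', t, he, he.frame, hq⟩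

/-- The loop rule, with the frame condition as a part of the invariant. -/
theorem runs_loop_frame {p : BExp} {c : Cmd} (σ₀ : State) (I : State → Prop) (Φ : State → ℕ)
    (h : I σ₀)
    (step : ∀ σ, Frame c σ₀ σ → I σ → p.Holds σ →
      Runs c σ (fun σ' t => I σ' ∧ t + (p.cost + 1) + Φ σ' ≤ Φ σ)) :
    Runs (.loop p c) σ₀
      (fun σ' t => Frame c σ₀ σ' ∧ I σ' ∧ ¬ p.Holds σ' ∧ t + Φ σ' ≤ Φ σ₀ + (p.cost + 1)) := by
  have := runs_loop (p := p) (c := c) (fun σ => Frame c σ₀ σ ∧ I σ) Φ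
    (fun σ hσ hp => (step σ hσ.1 hσ.2 hp).frame.mono
      (fun σ' t h => ⟨⟨hσ.1.trans h.1, h.2.1⟩, h.2.2⟩)) (σ := σ₀) ⟨Frame.refl _ _, h⟩
  exact this.mono (fun σ' t h => ⟨h.1.1, h.1.2, h.2⟩)

/-! ### Reading memory after a single write -/

section reads

variable (σ : State) (x y : NVar) (u w : RVar) (a b : NArr) (c d : RArr) (i j m : ℕ) (r : ℝ)

@[simp] theorem State.setN_nat : (σ.setN x m).nat y = if y = x then m else σ.nat y :=
  Function.update_apply _ _ _ _
@[simp] theorem State.setN_real : (σ.setN x m).real = σ.real := rfl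
@[simp] theorem State.setN_natArr : (σ.setN x m).natArr = σ.natArr := rfl
@[simp] theorem State.setN_realArr : (σ.setN x m).realArr = σ.realArr := rfl
@[simp] theorem State.setR_nat : (σ.setR u r).nat = σ.nat := rfl
@[simp] theorem State.setR_real : (σ.setR u r).real w = if w = u then r else σ.real w :=
  Function.update_apply _ _ _ _
@[simp] theorem State.setR_natArr : (σ.setR u r).natArr = σ.natArr := rfl
@[simp] theorem State.setR_realArr : (σ.setR u r).realArr = σ.realArr := rfl
@[simp] theorem State.putN_nat : (σ.putN a i m).nat = σ.nat := rfl
@[simp] theorem State.putN_real : (σ.putN a i m).real = σ.real := rfl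
@[simp] theorem State.putN_natArr : (σ.putN a i m).natArr b =
    if b = a then Function.update (σ.natArr a) i m else σ.natArr b :=
  Function.update_apply _ _ _ _
@[simp] theorem State.putN_realArr : (σ.putN a i m).realArr = σ.realArr := rfl
@[simp] theorem State.putR_nat : (σ.putR c i r).nat = σ.nat := rfl
@[simp] theorem State.putR_real : (σ.putR c i r).real = σ.real := rfl
@[simp] theorem State.putR_natArr : (σ.putR c i r).natArr = σ.natArr := rfl
@[simp] theorem State.putR_realArr : (σ.putR c i r).realArr d =
    if d = c then Function.update (σ.realArr c) i r else σ.realArr d :=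
  Function.update_apply _ _ _ _

end reads

attribute [simp] NExp.eval NExp.cost RExp.eval RExp.cost BExp.Holds BExp.cost
attribute [simp] runs_skip runs_setN runs_setR runs_putN runs_putR runs_seq runs_cond
attribute [simp] Cmd.WritesN Cmd.WritesR Cmd.WritesNArr Cmd.WritesRArr
attribute [simp] block

/-! ### Partitions and break points -/

theorem scalarRange_le_iff {n : ℕ} {α : Fin n → ℝ} {B : Finset (Fin n)} {h : B.Nonempty} {z : ℝ} :
    scalarRange α B h ≤ z ↔ ∀ x ∈ B, ∀ y ∈ B, α x - α y ≤ z := by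
  unfold scalarRange
  constructor
  · intro hz x hx y hy
    have h₁ := Finset.le_sup' α hx
    have h₂ := Finset.inf'_le α hy
    linarith
  · intro hz
    obtain ⟨x, hx, hxe⟩ := Finset.exists_mem_eq_sup' h α
    obtain ⟨y, hy, hye⟩ := Finset.exists_mem_eq_inf' h α
    rw [hxe, hye]
    exact hz x hx y hy

theorem KPartition.maxRange_le_iff {n k : ℕ} (hk : 1 ≤ k) {P : KPartition n k} {α : Fin n → ℝ}
    {z : ℝ} : P.maxRange α ≤ z ↔ ∀ j, ∀ x ∈ P.S j, ∀ y ∈ P.S j, α x - α y ≤ z := by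
  have : Nonempty (Fin k) := ⟨⟨0, hk⟩⟩
  unfold KPartition.maxRange
  rw [ciSup_le_iff (Set.finite_range _).bddAbove]
  simp only [scalarRange_le_iff]

theorem KPartition.maxRange_nonneg {n k : ℕ} (hk : 1 ≤ k) (P : KPartition n k) (α : Fin n → ℝ) :
    0 ≤ P.maxRange α := by
  obtain ⟨x, hx⟩ := P.nonempty ⟨0, hk⟩
  simpa using (KPartition.maxRange_le_iff hk).1 (le_refl (P.maxRange α)) ⟨0, hk⟩ x hx x hx

theorem KPartition.exists_maxRange_eq {n k : ℕ} (hk : 1 ≤ k) (P : KPartition n k)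
    (α : Fin n → ℝ) : ∃ j, ∃ x ∈ P.S j, ∃ y ∈ P.S j, P.maxRange α = α x - α y := by
  have : Nonempty (Fin k) := ⟨⟨0, hk⟩⟩
  obtain ⟨j, hj⟩ := exists_eq_ciSup_of_finite (f := fun j => scalarRange α (P.S j) (P.nonempty j))
  obtain ⟨x, hx, hxe⟩ := Finset.exists_mem_eq_sup' (P.nonempty j) α
  obtain ⟨y, hy, hye⟩ := Finset.exists_mem_eq_inf' (P.nonempty j) α
  refine ⟨j, x, hx, y, hy, ?_⟩
  rw [← hxe, ← hye]
  exact hj.symm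

/-- If there are fewer clusters than elements, the objective value is a candidate. -/
theorem KPartition.exists_lt_maxRange_eq {n k : ℕ} (hk : 1 ≤ k) (hkn : k < n)
    (P : KPartition n k) {α : Fin n → ℝ} (hα : StrictMono α) :
    ∃ x y : Fin n, x < y ∧ P.maxRange α = α y - α x := by
  choose f hf using P.cover
  -- Pigeonhole: two elements share a cluster, so the value is positive, and the pair that attains
  -- it cannot consist of equal elements.
  obtain ⟨x, y, hxy, hfxy⟩ := Fintype.exists_ne_map_eq_of_card_lt f (by simpa using hkn)
  have hle := (KPartition.maxRange_le_iff hk).1 (le_refl (P.maxRange α)) (f x)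
  have hx := hf x
  have hy := hf y
  rw [← hfxy] at hy
  have hpos : 0 < P.maxRange α := by
    rcases lt_or_gt_of_ne hxy with h | h
    · linarith [hle y hy x hx, hα h]
    · linarith [hle x hx y hy, hα h]
  obtain ⟨j, u, -, v, -, huv⟩ := P.exists_maxRange_eq hk α
  refine ⟨v, u, ?_, huv⟩
  rw [← hα.lt_iff_lt]
  linarith

/-- Ensures that the objective attains its minimum over all partitions. -/
instance (n k : ℕ) : Finite (KPartition n k) :=
  Finite.of_injective (fun P : KPartition n k => P.S) (by
    rintro ⟨S, _, _, _⟩ ⟨S', _, _, _⟩ h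
    cases h
    rfl)

theorem exists_block_of_lt {e : ℕ → ℕ} {i b : ℕ} (h0 : e 0 = 0) (hi : i < e b) :
    ∃ c < b, e c ≤ i ∧ i < e (c + 1) := by
  induction b with
  | zero => omega
  | succ b ih =>
    by_cases h : i < e b
    · obtain ⟨c, hc, h⟩ := ih h
      exact ⟨c, by omega, h⟩
    · exact ⟨b, by omega, by omega, hi⟩

theorem breakpoints_mono {e : ℕ → ℕ} {k : ℕ} (hlt : ∀ b < k, e b < e (b + 1)) {b c : ℕ}
    (hbc : b ≤ c) (hc : c ≤ k) : e b ≤ e c := by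
  induction c, hbc using Nat.le_induction with
  | base => exact le_rfl
  | succ c _ ih => exact (ih (by omega)).trans (hlt c (by omega)).le

/-- The partition into consecutive blocks with break points `e`. -/
def blockPartition {n k : ℕ} (e : ℕ → ℕ) (h0 : e 0 = 0) (hk : e k = n)
    (hlt : ∀ b < k, e b < e (b + 1)) : KPartition n k where
  S j := Finset.univ.filter (fun i : Fin n => e j ≤ i ∧ (i : ℕ) < e (j + 1))
  nonempty j := by
    have h₁ := hlt j j.2
    have h₂ := breakpoints_mono hlt (b := j + 1) (c := k) (by omega) le_rfl
    exact ⟨⟨e j, by omega⟩, by simp [h₁]⟩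
  disjoint j j' hne := by
    rw [Finset.disjoint_left]
    intro i hi hi'
    simp only [Finset.mem_filter, Finset.mem_univ, true_and] at hi hi'
    rcases lt_or_gt_of_ne hne with h | h
    · have := breakpoints_mono hlt (b := j + 1) (c := j') (by omega) (by omega)
      omega
    · have := breakpoints_mono hlt (b := j' + 1) (c := j) (by omega) (by omega)
      omega
  cover i := by
    obtain ⟨c, hc, h⟩ := exists_block_of_lt (b := k) (i := i) h0 (by omega)
    exact ⟨⟨c, hc⟩, by simpa using h⟩

theorem mem_blockPartition {n k : ℕ} {e : ℕ → ℕ} {h0 : e 0 = 0} {hk : e k = n}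
    {hlt : ∀ b < k, e b < e (b + 1)} {j : Fin k} {i : Fin n} :
    i ∈ (blockPartition e h0 hk hlt).S j ↔ e j ≤ i ∧ (i : ℕ) < e (j + 1) := by
  simp [blockPartition]

theorem blockPartition_isConsecutive {n k : ℕ} {e : ℕ → ℕ} (h0 : e 0 = 0) (hk : e k = n)
    (hlt : ∀ b < k, e b < e (b + 1)) : (blockPartition e h0 hk hlt).IsConsecutive :=
  ⟨e, h0, hk, fun _ _ => mem_blockPartition⟩

/-! ### The greedy scan -/

/-- An index beyond `n` satisfies the gap condition vacuously, so `Nat.find` can be applied. -/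
theorem exists_nextStart (a : ℕ → ℝ) (n : ℕ) (z : ℝ) (j : ℕ) :
    ∃ i, j < i ∧ (i < n → a j + z < a i) :=
  ⟨j + 1 + n, by omega, fun h => by omega⟩

open Classical in
/-- The first index behind the greedy interval that starts at `j`. -/
noncomputable def nextStart (a : ℕ → ℝ) (n : ℕ) (z : ℝ) (j : ℕ) : ℕ :=
  if j < n then Nat.find (exists_nextStart a n z j) else j

section greedy

variable {a : ℕ → ℝ} {n : ℕ} {z : ℝ}

theorem nextStart_of_le {j : ℕ} (h : n ≤ j) : nextStart a n z j = j := by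
  simp [nextStart, h]

theorem lt_nextStart {j : ℕ} (h : j < n) : j < nextStart a n z j := by
  classical
  simp only [nextStart, h, if_true]
  exact (Nat.find_spec (exists_nextStart a n z j)).1

theorem nextStart_le {j : ℕ} (h : j ≤ n) : nextStart a n z j ≤ n := by
  classical
  rcases h.lt_or_eq with h | h
  · simp only [nextStart, h, if_true]
    exact Nat.find_min' _ ⟨h, fun h => by omega⟩
  · rw [nextStart_of_le h.ge]
    exact h.le

theorem lt_of_nextStart_lt {j : ℕ} (hj : j < n) (h : nextStart a n z j < n) :
    a j + z < a (nextStart a n z j) := by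
  classical
  simp only [nextStart, hj, if_true] at h ⊢
  exact (Nat.find_spec (exists_nextStart a n z j)).2 h

theorem le_of_lt_nextStart {i j : ℕ} (h₁ : j < i) (h₂ : i < nextStart a n z j) :
    a i ≤ a j + z := by
  classical
  unfold nextStart at h₂
  split_ifs at h₂ with h
  · have := Nat.find_min _ h₂
    push Not at this
    exact (this h₁).2
  · omega

theorem nextStart_eq {i j : ℕ} (h₁ : j < i) (h₂ : i ≤ n)
    (h₃ : ∀ l, j < l → l < i → a l ≤ a j + z) (h₄ : i < n → a j + z < a i) :
    nextStart a n z j = i := by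
  rcases lt_trichotomy (nextStart a n z j) i with h | h | h
  · have := lt_of_nextStart_lt (z := z) (a := a) (n := n) (j := j) (by omega) (by omega)
    have := h₃ _ (lt_nextStart (by omega)) h
    linarith
  · exact h
  · have := nextStart_le (a := a) (n := n) (z := z) (j := j) (by omega)
    have := le_of_lt_nextStart h₁ h
    have := h₄ (by omega)
    linarith

/-- The start of the greedy interval number `b` (counted from `0`), or `n` if there is none. -/
noncomputable def greedyStart (a : ℕ → ℝ) (n : ℕ) (z : ℝ) : ℕ → ℕ
  | 0 => 0
  | b + 1 => nextStart a n z (greedyStart a n z b)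

theorem greedyStart_le (b : ℕ) : greedyStart a n z b ≤ n := by
  induction b with
  | zero => simp [greedyStart]
  | succ b ih => exact nextStart_le ih

theorem greedyStart_eq_of_le {b c : ℕ} (h : greedyStart a n z b = n) (hbc : b ≤ c) :
    greedyStart a n z c = n := by
  induction c, hbc using Nat.le_induction with
  | base => exact h
  | succ c _ ih => rw [greedyStart, ih, nextStart_of_le le_rfl]

theorem le_of_strictMono (ha : StrictMono (fun i : Fin n => a i)) {i j : ℕ} (hij : i ≤ j)
    (hj : j < n) : a i ≤ a j :=
  ha.monotone (a := ⟨i, by omega⟩) (b := ⟨j, hj⟩) hij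

theorem greedyStart_one (ha : StrictMono (fun i : Fin n => a i)) (hn : 1 ≤ n)
    (hz : a (n - 1) - a 0 ≤ z) : greedyStart a n z 1 = n := by
  refine nextStart_eq (j := 0) (by omega) le_rfl (fun l _ hl => ?_) (by simp)
  have := le_of_strictMono ha (i := l) (j := n - 1) (by omega) (by omega)
  linarith

/-- While the greedy scan is not finished, every interval has met a further cluster. -/
theorem card_clusters_met {k : ℕ} (hk : 1 ≤ k) (ha : StrictMono (fun i : Fin n => a i))
    (P : KPartition n k) (hP : P.maxRange (fun i : Fin n => a i) ≤ z) (b : ℕ)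
    (hb : greedyStart a n z b < n) :
    ∃ T : Finset (Fin k), T.card = b + 1 ∧
      ∀ j ∈ T, ∃ i ∈ P.S j, (i : ℕ) ≤ greedyStart a n z b := by
  rw [KPartition.maxRange_le_iff hk] at hP
  induction b with
  | zero =>
    obtain ⟨j, hj⟩ := P.cover ⟨_, hb⟩
    refine ⟨{j}, by simp, fun j' hj' => ?_⟩
    rw [Finset.mem_singleton.1 hj']
    exact ⟨_, hj, le_rfl⟩
  | succ b ih =>
    have hb' : greedyStart a n z b < n := by
      by_contra h
      have := greedyStart_eq_of_le (le_antisymm (greedyStart_le b) (not_lt.1 h))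
        (Nat.le_add_right b 1)
      omega
    obtain ⟨T, hT, hm⟩ := ih hb'
    have hlt : greedyStart a n z b < greedyStart a n z (b + 1) := lt_nextStart hb'
    have hgap : a (greedyStart a n z b) + z < a (greedyStart a n z (b + 1)) :=
      lt_of_nextStart_lt hb' hb
    obtain ⟨j, hj⟩ := P.cover ⟨_, hb⟩
    -- A cluster met earlier contains an element at or before the previous start. The new start
    -- exceeds that element by more than `z`, so it lies in a new cluster.
    have hjT : j ∉ T := by
      intro hjT
      obtain ⟨i, hi, hle⟩ := hm j hjT
      have h₁ := hP j _ hj i hi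
      have h₂ := le_of_strictMono ha hle hb'
      simp only at h₁
      linarith
    refine ⟨insert j T, by rw [Finset.card_insert_of_notMem hjT, hT], fun j' hj' => ?_⟩
    rcases Finset.mem_insert.1 hj' with rfl | hj'
    · exact ⟨_, hj, le_rfl⟩
    · obtain ⟨i, hi, hle⟩ := hm j' hj'
      exact ⟨i, hi, hle.trans hlt.le⟩

/-- A scan still unfinished after `k` intervals would have met `k + 1` of the `k` clusters. -/
theorem greedyStart_eq_of_partition {k : ℕ} (hk : 1 ≤ k)
    (ha : StrictMono (fun i : Fin n => a i)) (P : KPartition n k)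
    (hP : P.maxRange (fun i : Fin n => a i) ≤ z) : greedyStart a n z k = n := by
  by_contra h
  obtain ⟨T, hT, -⟩ := card_clusters_met hk ha P hP k (lt_of_le_of_ne (greedyStart_le k) h)
  have := T.card_le_univ
  rw [Fintype.card_fin] at this
  omega

/-! ### Slowing the scan down to exactly `k` blocks -/

/-- The break points of the greedy scan that leaves enough elements for `k` clusters. -/
noncomputable def cappedStart (a : ℕ → ℝ) (n k : ℕ) (z : ℝ) : ℕ → ℕ
  | 0 => 0
  | b + 1 => min (nextStart a n z (cappedStart a n k z b)) (n - k + b + 1)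

theorem cappedStart_zero {k : ℕ} : cappedStart a n k z 0 = 0 := rfl

theorem cappedStart_le {k : ℕ} (b : ℕ) : cappedStart a n k z b ≤ n - k + b := by
  cases b with
  | zero => simp [cappedStart]
  | succ b => exact min_le_right _ _

theorem cappedStart_lt_succ {k : ℕ} (hkn : k ≤ n) {b : ℕ} (hb : b < k) :
    cappedStart a n k z b < cappedStart a n k z (b + 1) := by
  have h := cappedStart_le (a := a) (n := n) (k := k) (z := z) b
  exact lt_min (lt_nextStart (by omega)) (by omega)

/-- Until the cap first binds, the two scans coincide. Afterwards it binds forever, because the scan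
advances by at least one element and the cap by exactly one. At `b = k` the cap equals `n`, so the
capped scan also ends at `n`. -/
theorem cappedStart_eq_or {k : ℕ} (hkn : k ≤ n) {b : ℕ} (hb : b ≤ k) :
    cappedStart a n k z b = greedyStart a n z b ∨ cappedStart a n k z b = n - k + b := by
  induction b with
  | zero => exact Or.inl rfl
  | succ b ih =>
    rcases ih (by omega) with h | h
    · rw [cappedStart, greedyStart, h]
      rcases min_choice (nextStart a n z (greedyStart a n z b)) (n - k + b + 1) with h | h <;>
        rw [h]
      · exact Or.inl rfl
      · exact Or.inr rfl
    · right
      rw [cappedStart, h, min_eq_right]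
      · rfl
      · exact lt_nextStart (by omega)

theorem cappedStart_last {k : ℕ} (hkn : k ≤ n) (h : greedyStart a n z k = n) :
    cappedStart a n k z k = n := by
  rcases cappedStart_eq_or (a := a) (z := z) hkn le_rfl with h' | h' <;> omega

/-- The partition formed by the greedy scan. -/
noncomputable def greedyPartition {k : ℕ} (hkn : k ≤ n) (h : greedyStart a n z k = n) :
    KPartition n k :=
  blockPartition (cappedStart a n k z) cappedStart_zero (cappedStart_last hkn h)
    (fun _ hb => cappedStart_lt_succ hkn hb)

theorem mem_greedyPartition {k : ℕ} {hkn : k ≤ n} {h : greedyStart a n z k = n} {j : Fin k}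
    {i : Fin n} : i ∈ (greedyPartition hkn h).S j ↔
      cappedStart a n k z j ≤ i ∧ (i : ℕ) < cappedStart a n k z (j + 1) :=
  mem_blockPartition

theorem greedyPartition_maxRange_le {k : ℕ} (hk : 1 ≤ k) (hkn : k ≤ n) (hz : 0 ≤ z)
    (ha : StrictMono (fun i : Fin n => a i)) (h : greedyStart a n z k = n) :
    (greedyPartition hkn h).maxRange (fun i : Fin n => a i) ≤ z := by
  rw [KPartition.maxRange_le_iff hk]
  intro j x hx y hy
  rw [mem_greedyPartition] at hx hy
  have h₁ : a (cappedStart a n k z j) ≤ a y := le_of_strictMono ha hy.1 y.2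
  have h₂ : a x ≤ a (cappedStart a n k z j) + z := by
    rcases hx.1.lt_or_eq with h | h
    · exact le_of_lt_nextStart h (hx.2.trans_le (min_le_left _ _))
    · rw [h]
      linarith
  linarith

/-- The greedy scan with at most `k` intervals decides feasibility. -/
theorem exists_partition_iff {k : ℕ} (hk : 1 ≤ k) (hkn : k ≤ n) (hz : 0 ≤ z)
    (ha : StrictMono (fun i : Fin n => a i)) :
    (∃ P : KPartition n k, P.maxRange (fun i : Fin n => a i) ≤ z) ↔ greedyStart a n z k = n :=
  ⟨fun ⟨P, hP⟩ => greedyStart_eq_of_partition hk ha P hP,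
    fun h => ⟨_, greedyPartition_maxRange_le hk hkn hz ha h⟩⟩

end greedy

/-- The scans and the machine arrays are indexed by `ℕ`; the values beyond `n` play no role. -/
theorem exists_extension {n : ℕ} (α : Fin n → ℝ) : ∃ a : ℕ → ℝ, α = fun i : Fin n => a i :=
  ⟨fun i => if h : i < n then α ⟨i, h⟩ else 0, by ext i; simp⟩

/-- Greedy blocks for the value of an optimal partition are no worse than that partition. -/
theorem exists_optimal_consecutive {n k : ℕ} {α : Fin n → ℝ} (hα : StrictMono α) (hk : 1 ≤ k)
    (hkn : k ≤ n) : ∃ P : KPartition n k, P.IsOptimal α ∧ P.IsConsecutive := by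
  obtain ⟨a, rfl⟩ := exists_extension α
  -- With the full spread as `z` one interval covers everything, so the set of `k`-partitions is
  -- non-empty.
  have hone := greedyStart_eq_of_le (greedyStart_one hα (by omega) le_rfl) hk
  have : Nonempty (KPartition n k) := ⟨greedyPartition hkn hone⟩
  obtain ⟨Q, hQ⟩ := Finite.exists_min
    (fun P : KPartition n k => P.maxRange (fun i : Fin n => a i))
  have h := greedyStart_eq_of_partition hk hα Q le_rfl
  exact ⟨greedyPartition hkn h,
    fun R => (greedyPartition_maxRange_le hk hkn (Q.maxRange_nonneg hk _) hα h).trans (hQ R),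
    blockPartition_isConsecutive _ _ _⟩

/-! ### The scans of the algorithm -/

/-- The inner loop of the feasibility check runs to the end of the greedy interval. -/
theorem runs_extend {σ : State} {n j : ℕ} {a : ℕ → ℝ} {z : ℝ} (hn : σ.nat .n = n)
    (ha : σ.realArr .alpha = a) (hz : σ.real .z = z) (hj : σ.nat .j = j + 1) (hjn : j < n)
    (hs : σ.real .s = a j) :
    Runs (.loop (.and (.natLt (.var .j) (.var .n))
            (.realLe (.get .alpha (.var .j)) (.add (.var .s) (.var .z))))
          (.setN .j (.add (.var .j) (.const 1)))) σ
      (fun σ' t => σ'.nat .j = nextStart a n z j ∧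
        t + 15 * (n - nextStart a n z j) ≤ 15 * (n - (j + 1)) + 11) := by
  refine (runs_loop_frame σ
    (fun τ => j < τ.nat .j ∧ τ.nat .j ≤ n ∧ ∀ l, j < l → l < τ.nat .j → a l ≤ a j + z)
    (fun τ => 15 * (n - τ.nat .j)) ⟨by omega, by omega, fun l _ _ => by omega⟩ ?_).mono ?_
  · rintro τ hF ⟨h₁, h₂, h₃⟩ hp
    have e₁ := hF.nat .n (by simp)
    have e₂ := hF.real .z (by simp)
    have e₃ := hF.real .s (by simp)
    have e₄ := hF.realArr .alpha (by simp)
    simp only [BExp.Holds, NExp.eval, RExp.eval, e₁, e₂, e₃, e₄, hn, ha, hz, hs] at hp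
    simp only [runs_setN, NExp.eval, NExp.cost, BExp.cost, RExp.cost, State.setN_nat, if_true]
    refine ⟨⟨by omega, by omega, fun l hl hl' => ?_⟩, by omega⟩
    rcases (Nat.lt_succ_iff_lt_or_eq.1 hl') with h | h
    · exact h₃ l hl h
    · rw [h]
      exact hp.2
  · rintro τ t ⟨hF, ⟨h₁, h₂, h₃⟩, hp, ht⟩
    have e₁ := hF.nat .n (by simp)
    have e₂ := hF.real .z (by simp)
    have e₃ := hF.real .s (by simp)
    have e₄ := hF.realArr .alpha (by simp)
    simp only [BExp.Holds, NExp.eval, RExp.eval, e₁, e₂, e₃, e₄, hn, ha, hz, hs, not_and,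
      not_le] at hp
    have := nextStart_eq h₁ h₂ h₃ hp
    rw [this]
    simp only [NExp.cost, BExp.cost, RExp.cost] at ht
    exact ⟨rfl, by omega⟩

theorem runs_feasibilityCheck {σ : State} {n k : ℕ} {a : ℕ → ℝ} {z : ℝ} (hn : σ.nat .n = n)
    (hk : σ.nat .k = k) (ha : σ.realArr .alpha = a) (hz : σ.real .z = z) :
    Runs feasibilityCheck σ (fun σ' t => t ≤ 31 * n + 20 ∧
      (σ'.nat .ok = 0 ∨ σ'.nat .ok = 1) ∧
      (σ'.nat .ok = 1 ↔ greedyStart a n z k = n)) := by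
  simp only [feasibilityCheck, block, List.foldr, runs_seq, runs_setN, NExp.eval, NExp.cost]
  -- Every pass consumes at least one element, so 31 steps per element pay both for the inner loop,
  -- at 15 per element, and for the constant overhead of the pass.
  refine (runs_loop_frame _
    (fun τ => τ.nat .j = greedyStart a n z (τ.nat .b) ∧ τ.nat .b ≤ k)
    (fun τ => 31 * (n - τ.nat .j)) (by simp [greedyStart]) ?_).mono ?_
  · rintro τ hF ⟨h₁, h₂⟩ hp
    have e₁ := hF.nat .n (by simp)
    have e₂ := hF.nat .k (by simp)
    have e₃ := hF.real .z (by simp)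
    have e₄ := hF.realArr .alpha (by simp)
    simp at e₁ e₂ e₃ e₄
    simp only [BExp.Holds, NExp.eval, e₁, e₂, hn, hk] at hp
    simp only [runs_seq, runs_setN, runs_setR, NExp.eval, RExp.eval, NExp.cost, RExp.cost]
    refine (runs_extend (n := n) (j := τ.nat .j) (a := a) (z := z) ?_ ?_ ?_ ?_ hp.2 ?_).frame.mono
      ?_
    · simp [e₁, hn]
    · simp [e₄, ha]
    · simp [e₃, hz]
    · simp
    · simp [e₄, ha]
    · rintro τ' t ⟨hF', hj, ht⟩
      have f₁ := hF'.nat .b (by simp)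
      simp at f₁
      have := lt_nextStart (a := a) (z := z) hp.2
      have := nextStart_le (a := a) (z := z) hp.2.le
      simp only [runs_skip, State.setN_nat, if_true, f₁, reduceCtorEq, if_false, hj, BExp.cost,
        NExp.cost]
      refine ⟨⟨?_, by omega⟩, by omega⟩
      rw [greedyStart, h₁]
  · rintro τ t ⟨hF, ⟨h₁, h₂⟩, hp, ht⟩
    have e₁ := hF.nat .n (by simp)
    have e₂ := hF.nat .k (by simp)
    simp at e₁ e₂
    simp only [BExp.Holds, NExp.eval, e₁, e₂, hn, hk] at hp
    have hle := greedyStart_le (a := a) (n := n) (z := z) (τ.nat .b)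
    -- The loop may stop before `b = k`, but then the scan has reached `n` and stays there for the
    -- remaining intervals.
    have key : n ≤ τ.nat .j ↔ greedyStart a n z k = n := by
      constructor
      · intro h
        exact greedyStart_eq_of_le (by omega) h₂
      · intro h
        by_contra h'
        have : τ.nat .b = k := by omega
        rw [h₁, this] at h'
        omega
    simp [BExp.cost, NExp.cost, State.setN_nat] at ht
    simp only [runs_cond, runs_setN, runs_skip, BExp.Holds, NExp.eval, e₁, hn, BExp.cost,
      NExp.cost, State.setN_nat, if_true, ← key]
    exact ⟨fun h => ⟨by omega, .inl trivial, by omega⟩,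
      fun h => ⟨by omega, .inr trivial, by simp only [true_iff]; omega⟩⟩

/-- The inner loop of the output phase labels one cluster. -/
theorem runs_labelCluster {σ : State} {n k j b : ℕ} {a : ℕ → ℝ} {z : ℝ} (hn : σ.nat .n = n)
    (hk : σ.nat .k = k) (hb : σ.nat .b = b) (ha : σ.realArr .alpha = a) (hz : σ.real .z = z)
    (hj : σ.nat .j = j + 1) (hkn : k ≤ n) (hjn : j ≤ n - k + b) (hbk : b < k)
    (hs : σ.real .s = a j) :
    Runs (.loop (.and (.natLe (.add (.var .j) (.var .k)) (.add (.var .n) (.var .b)))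
            (.realLe (.get .alpha (.var .j)) (.add (.var .s) (.var .z))))
          (block
            [.putN .label (.var .j) (.var .b),
             .setN .j (.add (.var .j) (.const 1))])) σ
      (fun σ' t => σ'.nat .j = min (nextStart a n z j) (n - k + b + 1) ∧
        (∀ i, j < i → i < σ'.nat .j → σ'.natArr .label i = b) ∧
        (∀ i, i ≤ j → σ'.natArr .label i = σ.natArr .label i) ∧
        t + 23 * (n - σ'.nat .j) ≤ 23 * (n - (j + 1)) + 15) := by
  refine (runs_loop_frame σ
    (fun τ => j < τ.nat .j ∧ τ.nat .j ≤ n - k + b + 1 ∧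
      (∀ l, j < l → l < τ.nat .j → a l ≤ a j + z) ∧
      (∀ i, j < i → i < τ.nat .j → τ.natArr .label i = b) ∧
      (∀ i, i ≤ j → τ.natArr .label i = σ.natArr .label i))
    (fun τ => 23 * (n - τ.nat .j))
    ⟨by omega, by omega, fun l _ _ => by omega, fun l _ _ => by omega, fun _ _ => rfl⟩ ?_).mono ?_
  · rintro τ hF ⟨h₁, h₂, h₃, h₄, h₅⟩ hp
    have e₁ := hF.nat .n (by simp)
    have e₂ := hF.real .z (by simp)
    have e₃ := hF.real .s (by simp)
    have e₄ := hF.realArr .alpha (by simp)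
    have e₅ := hF.nat .k (by simp)
    have e₆ := hF.nat .b (by simp)
    simp only [BExp.Holds, NExp.eval, RExp.eval, e₁, e₂, e₃, e₄, e₅, e₆, hn, ha, hz, hs, hk,
      hb] at hp
    simp [BExp.cost, NExp.cost, RExp.cost, e₆, hb]
    refine ⟨⟨by omega, by omega, fun l hl hl' => ?_, fun i hi hi' => ?_, fun i hi => ?_⟩, by omega⟩
    · rcases hl'.lt_or_eq with h | h
      · exact h₃ l hl h
      · rw [h]
        exact hp.2
    · rw [Function.update_apply]
      split_ifs with h
      · rfl
      · exact h₄ i hi (by omega)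
    · rw [Function.update_of_ne (by omega)]
      exact h₅ i hi
  · rintro τ t ⟨hF, ⟨h₁, h₂, h₃, h₄, h₅⟩, hp, ht⟩
    have e₁ := hF.nat .n (by simp)
    have e₂ := hF.real .z (by simp)
    have e₃ := hF.real .s (by simp)
    have e₄ := hF.realArr .alpha (by simp)
    have e₅ := hF.nat .k (by simp)
    have e₆ := hF.nat .b (by simp)
    simp only [BExp.Holds, NExp.eval, RExp.eval, e₁, e₂, e₃, e₄, e₅, e₆, hn, ha, hz, hs, hk,
      hb, not_and, not_le] at hp
    simp only [NExp.cost, BExp.cost, RExp.cost] at ht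
    refine ⟨?_, h₄, h₅, by omega⟩
    rcases h₂.lt_or_eq with h | h
    · rw [nextStart_eq h₁ (by omega) h₃ (fun _ => hp (by omega)), min_eq_left h₂]
    -- The loop ran up to the cap: everything before the cap is within `z` of the start, so the
    -- greedy interval cannot end earlier.
    · rw [h, min_eq_right]
      by_contra hlt
      have h₆ := lt_of_nextStart_lt (a := a) (z := z) (n := n) (j := j) (by omega) (by omega)
      have h₇ := h₃ (nextStart a n z j) (lt_nextStart (by omega)) (by omega)
      linarith

theorem runs_writeClusters {σ : State} {n k : ℕ} {a : ℕ → ℝ} {z : ℝ} (hn : σ.nat .n = n)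
    (hk : σ.nat .k = k) (ha : σ.realArr .alpha = a) (hz : σ.real .z = z) (hkn : k ≤ n) :
    Runs writeClusters σ (fun σ' t => t ≤ 40 * n + 20 ∧ σ'.real .z = z ∧
      ∀ b < k, ∀ i, cappedStart a n k z b ≤ i → i < cappedStart a n k z (b + 1) →
        σ'.natArr .label i = b) := by
  simp only [writeClusters, block, List.foldr, runs_seq, runs_setN, NExp.eval, NExp.cost]
  refine (runs_loop_frame _
    (fun τ => τ.nat .b ≤ k ∧ τ.nat .j = cappedStart a n k z (τ.nat .b) ∧
      ∀ b < τ.nat .b, ∀ i, cappedStart a n k z b ≤ i → i < cappedStart a n k z (b + 1) →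
        τ.natArr .label i = b)
    (fun τ => 40 * (n - τ.nat .j)) (by simp [cappedStart]) ?_).mono ?_
  · rintro τ hF ⟨h₁, h₂, h₃⟩ hp
    have e₁ := hF.nat .n (by simp)
    have e₂ := hF.nat .k (by simp)
    have e₃ := hF.real .z (by simp)
    have e₄ := hF.realArr .alpha (by simp)
    simp at e₁ e₂ e₃ e₄
    simp only [BExp.Holds, NExp.eval, e₂, hk] at hp
    have hcap := cappedStart_le (a := a) (n := n) (z := z) (k := k) (τ.nat .b)
    have hlt := cappedStart_lt_succ (a := a) (z := z) hkn hp
    have hcap' := cappedStart_le (a := a) (n := n) (z := z) (k := k) (τ.nat .b + 1)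
    simp only [runs_seq, runs_setN, runs_setR, runs_putN, NExp.eval, RExp.eval, NExp.cost,
      RExp.cost]
    refine (runs_labelCluster (n := n) (j := τ.nat .j) (a := a) (z := z) (k := k) (b := τ.nat .b)
      ?_ ?_ ?_ ?_ ?_ ?_ hkn (by omega) hp ?_).frame.mono ?_
    · simp [e₁, hn]
    · simp [e₂, hk]
    · simp
    · simp [e₄, ha]
    · simp [e₃, hz]
    · simp
    · simp [e₄, ha]
    · rintro τ' t ⟨hF', hj, hl₁, hl₂, ht⟩
      have f₁ := hF'.nat .b (by simp)
      simp at f₁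
      simp at hl₂
      have hj : τ'.nat .j = cappedStart a n k z (τ.nat .b + 1) := by
        rw [cappedStart, ← h₂, hj]
      simp only [runs_skip, State.setN_nat, if_true, f₁, reduceCtorEq, if_false, BExp.cost,
        NExp.cost, State.setN_natArr]
      refine ⟨⟨by omega, hj, fun b hb i hi hi' => ?_⟩, by omega⟩
      rcases Nat.lt_succ_iff_lt_or_eq.1 hb with h | h
      · have := breakpoints_mono (k := k) 
          (fun b hb => cappedStart_lt_succ (a := a) (z := z) hkn (b := b) hb)
          (b := b + 1) (c := τ.nat .b) (by omega) (by omega)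
        rw [hl₂ i (by omega), Function.update_of_ne (by omega)]
        exact h₃ b h i hi hi'
      · subst h
        rcases hi.lt_or_eq with h | h
        · exact hl₁ i (by omega) (by omega)
        · rw [hl₂ i (by omega), ← h, ← h₂]
          simp
  · rintro τ t ⟨hF, ⟨h₁, h₂, h₃⟩, hp, ht⟩
    have e₂ := hF.nat .k (by simp)
    have e₃ := hF.real .z (by simp)
    simp at e₂ e₃
    simp only [BExp.Holds, NExp.eval, e₂, hk] at hp
    simp [BExp.cost, NExp.cost, State.setN_nat] at ht
    have : τ.nat .b = k := by omega
    rw [this] at h₃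
    simp only [runs_skip]
    exact ⟨by omega, e₃.trans hz, h₃⟩

/-! ### Ranks of candidate values -/

/-- In a non-increasing list the entries `> x` form a prefix, and so do the entries `≥ x`. Position
`r` lies in the second prefix but not in the first. -/
theorem sorted_getElem?_of_countP {x : ℝ} {L : List ℝ} (hL : L.Pairwise (· ≥ ·)) {r : ℕ}
    (h₁ : L.countP (fun y => x < y) ≤ r) (h₂ : r < L.countP (fun y => x ≤ y)) :
    L[r]? = some x := by
  induction L generalizing r with
  | nil => simp at h₂
  | cons y L ih =>
    rw [List.pairwise_cons] at hL
    obtain ⟨hy, hL⟩ := hL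
    have hxy : x ≤ y := by
      by_contra hlt
      have : (y :: L).countP (fun y => x ≤ y) = 0 := by
        rw [List.countP_eq_zero]
        intro w hw
        rcases List.mem_cons.1 hw with rfl | hw
        · simpa using hlt
        · have := hy w hw
          simp only [decide_eq_true_eq, not_le] at hlt ⊢
          linarith
      omega
    rw [List.countP_cons_of_pos (by simpa using hxy)] at h₂
    cases r with
    | zero =>
      have : ¬ x < y := by
        intro h
        rw [List.countP_cons_of_pos (by simpa using h)] at h₁
        omega
      simp [le_antisymm hxy (not_lt.1 this)]
    | succ r =>
      rw [List.getElem?_cons_succ]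
      refine ih hL ?_ (by omega)
      rcases hxy.lt_or_eq with h | h
      · rw [List.countP_cons_of_pos (by simpa using h)] at h₁
        omega
      · have : L.countP (fun y => x < y) = 0 := by
          rw [List.countP_eq_zero]
          intro w hw
          have := hy w hw
          simp only [decide_eq_true_eq, not_lt]
          linarith
        omega

theorem countP_of_sorted_getElem? {x : ℝ} {L : List ℝ} (hL : L.Pairwise (· ≥ ·)) {r : ℕ}
    (h : L[r]? = some x) :
    L.countP (fun y => x < y) ≤ r ∧ r < L.countP (fun y => x ≤ y) := by
  induction L generalizing r with
  | nil => simp at h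
  | cons y L ih =>
    rw [List.pairwise_cons] at hL
    obtain ⟨hy, hL⟩ := hL
    cases r with
    | zero =>
      simp only [List.getElem?_cons_zero, Option.some.injEq] at h
      subst h
      constructor
      · rw [Nat.le_zero, List.countP_eq_zero]
        intro w hw
        rcases List.mem_cons.1 hw with rfl | hw
        · simp
        · simpa using hy w hw
      · rw [List.countP_cons_of_pos (by simp)]
        omega
    | succ r =>
      rw [List.getElem?_cons_succ] at h
      obtain ⟨h₁, h₂⟩ := ih hL h
      have hxy : x ≤ y := hy x (List.mem_of_getElem? h)
      rw [List.countP_cons, List.countP_cons_of_pos (by simpa using hxy)]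
      constructor
      · split_ifs <;> omega
      · omega

open Classical in
/-- The number of candidates greater than `x`. -/
noncomputable def numAbove {n : ℕ} (α : Fin n → ℝ) (x : ℝ) : ℕ :=
  ((Finset.univ : Finset (Fin n × Fin n)).filter
    (fun p => p.1 < p.2 ∧ x < α p.2 - α p.1)).card

open Classical in
/-- The number of candidates that are at least `x`. -/
noncomputable def numAtLeast {n : ℕ} (α : Fin n → ℝ) (x : ℝ) : ℕ :=
  ((Finset.univ : Finset (Fin n × Fin n)).filter
    (fun p => p.1 < p.2 ∧ x ≤ α p.2 - α p.1)).card

section ranks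

variable {n : ℕ} {α : Fin n → ℝ}

theorem countP_sort_candidates (q : ℝ → Prop) [DecidablePred q] :
    ((candidates α).sort (· ≥ ·)).countP (fun y => q y) =
      ((Finset.univ : Finset (Fin n × Fin n)).filter
        (fun p => p.1 < p.2 ∧ q (α p.2 - α p.1))).card := by
  rw [← Multiset.coe_countP, Multiset.sort_eq, candidates, Multiset.countP_map,
    ← Finset.filter_filter]
  rfl

theorem card_pairs (n : ℕ) :
    ((Finset.univ : Finset (Fin n × Fin n)).filter (fun p => p.1 < p.2)).card = n.choose 2 := by
  rw [Finset.card_filter, Fintype.sum_prod_type_right, Nat.choose_two_right,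
    ← Finset.sum_range_id, ← Fin.sum_univ_eq_sum_range]
  refine Finset.sum_congr rfl (fun q _ => ?_)
  rw [← Finset.card_filter]
  have : Finset.univ.filter (fun p : Fin n => p < q) = Finset.Iio q := by
    ext
    simp
  rw [this, Fin.card_Iio]

theorem length_sort_candidates :
    ((candidates α).sort (· ≥ ·)).length = n.choose 2 := by
  rw [Multiset.length_sort, candidates, Multiset.card_map, ← card_pairs]
  rfl

/-- Replaces positions in a sorted list by two counts, which the machine can compute without sorting
and which remain meaningful when values coincide. -/
theorem isNthLongest_iff {r : ℕ} {x : ℝ} :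
    IsNthLongest α r x ↔ numAbove α x < r ∧ r ≤ numAtLeast α x := by
  classical
  have hL : ((candidates α).sort (· ≥ ·)).Pairwise (· ≥ ·) := Multiset.pairwise_sort _ _
  have e₁ := countP_sort_candidates (α := α) (fun y => x < y)
  have e₂ := countP_sort_candidates (α := α) (fun y => x ≤ y)
  have d₁ : numAbove α x = ((candidates α).sort (· ≥ ·)).countP (fun y => decide (x < y)) := by
    rw [e₁, numAbove]
  have d₂ : numAtLeast α x = ((candidates α).sort (· ≥ ·)).countP (fun y => decide (x ≤ y)) := by
    rw [e₂, numAtLeast]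
  rw [d₁, d₂]
  constructor
  · rintro ⟨hr, h⟩
    obtain ⟨h₁, h₂⟩ := countP_of_sorted_getElem? hL h
    omega
  · rintro ⟨h₁, h₂⟩
    exact ⟨by omega, sorted_getElem?_of_countP hL (by omega) (by omega)⟩

theorem numAtLeast_le_numAbove {x y : ℝ} (h : x < y) : numAtLeast α y ≤ numAbove α x := by
  refine Finset.card_le_card (fun p hp => ?_)
  simp only [Finset.mem_filter] at hp ⊢
  exact ⟨hp.1, hp.2.1, by linarith⟩

theorem numAbove_anti {x y : ℝ} (h : x ≤ y) : numAbove α y ≤ numAbove α x := by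
  refine Finset.card_le_card (fun p hp => ?_)
  simp only [Finset.mem_filter] at hp ⊢
  exact ⟨hp.1, hp.2.1, by linarith⟩

theorem numAtLeast_anti {x y : ℝ} (h : x ≤ y) : numAtLeast α y ≤ numAtLeast α x := by
  refine Finset.card_le_card (fun p hp => ?_)
  simp only [Finset.mem_filter] at hp ⊢
  exact ⟨hp.1, hp.2.1, by linarith⟩

theorem IsNthLongest.anti {r s : ℕ} {x y : ℝ} (hx : IsNthLongest α r x)
    (hy : IsNthLongest α s y) (h : r ≤ s) : y ≤ x := by
  rw [isNthLongest_iff] at hx hy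
  by_contra hlt
  have := numAtLeast_le_numAbove (α := α) (not_le.1 hlt)
  omega

theorem exists_isNthLongest {r : ℕ} (h₁ : 1 ≤ r) (h₂ : r ≤ n.choose 2) :
    ∃ x, IsNthLongest α r x := by
  have h : r - 1 < ((candidates α).sort (· ≥ ·)).length := by
    rw [length_sort_candidates]
    omega
  exact ⟨_, h₁, List.getElem?_eq_getElem h⟩

theorem IsNthLongest.exists_pair {r : ℕ} {x : ℝ} (h : IsNthLongest α r x) :
    ∃ p q : Fin n, p < q ∧ x = α q - α p := by
  have := List.mem_of_getElem? h.2
  rw [Multiset.mem_sort, candidates, Multiset.mem_map] at this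
  obtain ⟨⟨p, q⟩, hpq, hx⟩ := this
  exact ⟨p, q, (Finset.mem_filter.1 hpq).2, hx.symm⟩

theorem IsNthLongest.pos (hα : StrictMono α) {r : ℕ} {x : ℝ} (h : IsNthLongest α r x) :
    0 < x := by
  obtain ⟨p, q, hpq, rfl⟩ := h.exists_pair
  linarith [hα hpq]

theorem exists_isNthLongest_sub {p q : Fin n} (hpq : p < q) :
    ∃ r, 1 ≤ r ∧ r ≤ n.choose 2 ∧ IsNthLongest α r (α q - α p) := by
  have hm : α q - α p ∈ (candidates α).sort (· ≥ ·) := by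
    rw [Multiset.mem_sort, candidates, Multiset.mem_map]
    exact ⟨(p, q), Finset.mem_filter.2 ⟨Finset.mem_univ _, hpq⟩, rfl⟩
  obtain ⟨i, hi, he⟩ := List.getElem_of_mem hm
  rw [length_sort_candidates] at hi
  exact ⟨i + 1, by omega, by omega, by omega, by rw [← he]; simp⟩

end ranks

/-! ### Logarithmic bounds -/

/-- Bit length serves as integer logarithm: halving loses at least one bit, which pays for one round
of a search. -/
theorem size_add_one_le {d e : ℕ} (he : 1 ≤ e) (h : d ≤ e / 2) : d.size + 1 ≤ e.size := by
  have h₁ : 0 < e.size := Nat.size_pos.2 he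
  have h₂ := Nat.lt_size_self e
  have h₃ : 2 ^ e.size = 2 * 2 ^ (e.size - 1) := by
    rw [← pow_succ']
    congr 1
    omega
  have : d.size ≤ e.size - 1 := Nat.size_le.2 (by omega)
  omega

theorem size_choose_two_le (n : ℕ) : (n.choose 2).size ≤ 2 * n.size := by
  rw [Nat.size_le]
  have h := Nat.lt_size_self n
  calc n.choose 2 ≤ n * n := by
        rw [Nat.choose_two_right]
        exact (Nat.div_le_self _ _).trans (Nat.mul_le_mul_left _ (Nat.sub_le _ _))
    _ < 2 ^ n.size * 2 ^ n.size := Nat.mul_lt_mul'' h h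
    _ = 2 ^ (2 * n.size) := by rw [← pow_add, two_mul]

theorem half_le_log {n : ℕ} (hn : 2 ≤ n) : 1 / 2 ≤ Real.log n := by
  have h₁ : Real.log 2 ≤ Real.log n := Real.log_le_log (by norm_num) (by exact_mod_cast hn)
  linarith [Real.log_two_gt_d9]

/-- In `size n ≤ log₂ n + 1` the additive one is itself at most `log₂ n` for `n ≥ 2`, and `2 / log 2
< 4`. -/
theorem size_le_log {n : ℕ} (hn : 2 ≤ n) : (n.size : ℝ) ≤ 4 * Real.log n := by
  have h₁ : Real.log 2 ≤ Real.log n := Real.log_le_log (by norm_num) (by exact_mod_cast hn)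
  have h₂ := Real.log_two_gt_d9
  have hs : 0 < n.size := Nat.size_pos.2 (by omega)
  have h₃ : 2 ^ (n.size - 1) ≤ n := Nat.lt_size.1 (by omega)
  have h₄ : ((n.size - 1 : ℕ) : ℝ) * Real.log 2 ≤ Real.log n := by
    rw [← Real.log_pow]
    exact Real.log_le_log (by positivity) (by exact_mod_cast h₃)
  have h₅ : ((n.size - 1 : ℕ) : ℝ) = n.size - 1 := by
    rw [Nat.cast_sub hs, Nat.cast_one]
  rw [h₅] at h₄
  have h₆ : (1 : ℝ) ≤ n.size := by exact_mod_cast hs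
  nlinarith

/-! ### The search for the optimal value -/

theorem runs_countPairs {σ : State} {n : ℕ} (hn : σ.nat .n = n) (h1 : 1 ≤ n) :
    Runs countPairs σ (fun σ' t => σ'.nat .total = n.choose 2 ∧ t ≤ 13 * n + 9) := by
  simp only [countPairs, block, List.foldr, runs_seq, runs_setN, NExp.eval, NExp.cost]
  refine (runs_loop_frame _
    (fun τ => τ.nat .total = (τ.nat .j).choose 2 ∧ τ.nat .j ≤ n)
    (fun τ => 13 * (n - τ.nat .j)) (by simp [h1]) ?_).mono ?_
  · rintro τ hF ⟨h₁, h₂⟩ hp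
    have e₁ := hF.nat .n (by simp)
    simp at e₁
    simp only [BExp.Holds, NExp.eval, e₁, hn] at hp
    simp only [runs_seq, runs_setN, runs_skip, NExp.eval, NExp.cost, State.setN_nat, if_true,
      reduceCtorEq, if_false, BExp.cost]
    refine ⟨⟨?_, by omega⟩, by omega⟩
    rw [h₁, Nat.choose_succ_succ', Nat.choose_one_right, add_comm]
  · rintro τ t ⟨hF, ⟨h₁, h₂⟩, hp, ht⟩
    have e₁ := hF.nat .n (by simp)
    simp at e₁
    simp only [BExp.Holds, NExp.eval, e₁, hn] at hp
    simp [BExp.cost, NExp.cost, State.setN_nat] at ht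
    have : τ.nat .j = n := by omega
    rw [this] at h₁
    simp only [runs_skip]
    exact ⟨h₁, by omega⟩

/-- `M` computes ranks for the scalars `a 0, …, a (n - 1)` in at most `T` steps. -/
def SelectsWithin (M : Cmd) (a : ℕ → ℝ) (n T : ℕ) : Prop :=
  ∀ (r : ℕ) (σ : State), 1 ≤ r → r ≤ n.choose 2 → σ.nat .n = n → σ.realArr .alpha = a →
    σ.nat .rank = r →
    Runs M σ (fun σ' t => t ≤ T ∧ IsNthLongest (fun i : Fin n => a i) r (σ'.real .z) ∧
      σ.AgreesOffScratch σ')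

/-- The state of the binary search: the `aMax`-th smallest candidate is feasible, and the candidates
before the `aMin`-th smallest are not. -/
structure SearchInv (a : ℕ → ℝ) (n k : ℕ) (τ : State) : Prop where
  n_eq : τ.nat .n = n
  k_eq : τ.nat .k = k
  total_eq : τ.nat .total = n.choose 2
  alpha_eq : τ.realArr .alpha = a
  one_le : 1 ≤ τ.nat .aMin
  le : τ.nat .aMin ≤ τ.nat .aMax
  le_total : τ.nat .aMax ≤ n.choose 2
  feasible : ∀ x, IsNthLongest (fun i : Fin n => a i) (n.choose 2 + 1 - τ.nat .aMax) x →
    greedyStart a n x k = n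
  infeasible : ∀ m, 1 ≤ m → m < τ.nat .aMin → ∀ x,
    IsNthLongest (fun i : Fin n => a i) (n.choose 2 + 1 - m) x → greedyStart a n x k ≠ n

/-- Monotonicity is read off from partitions, which avoids comparing two scans interval by interval.
-/
theorem greedyStart_eq_of_le_value {a : ℕ → ℝ} {n k : ℕ} {y z : ℝ} (hk : 1 ≤ k) (hkn : k ≤ n)
    (ha : StrictMono (fun i : Fin n => a i)) (hy : 0 ≤ y) (hyz : y ≤ z)
    (h : greedyStart a n y k = n) : greedyStart a n z k = n := by
  obtain ⟨P, hP⟩ := (exists_partition_iff hk hkn hy ha).2 h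
  exact greedyStart_eq_of_partition hk ha P (hP.trans hyz)

section search

variable {M : Cmd} {a : ℕ → ℝ} {n k T : ℕ}

theorem runs_searchStep (ha : StrictMono (fun i : Fin n => a i)) (hk : 1 ≤ k) (hkn : k ≤ n)
    (hM : SelectsWithin M a n T) {τ : State} (hI : SearchInv a n k τ)
    (hp : τ.nat .aMin < τ.nat .aMax) :
    Runs (block
       [.setN .m (.half (.add (.var .aMin) (.var .aMax))),
        .setN .rank (.sub (.add (.var .total) (.const 1)) (.var .m)),
        M,
        feasibilityCheck,
        .cond (.natLt (.const 0) (.var .ok))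
          (.setN .aMax (.var .m))
          (.setN .aMin (.add (.var .m) (.const 1)))]) τ
      (fun τ' t => SearchInv a n k τ' ∧ t ≤ T + 31 * n + 50 ∧
        τ'.nat .aMax - τ'.nat .aMin ≤ (τ.nat .aMax - τ.nat .aMin) / 2) := by
  obtain ⟨h₁, h₂, h₃, h₄, h₅, h₆, h₇, h₈, h₉⟩ := hI
  obtain ⟨m, hm⟩ : ∃ m, m = (τ.nat .aMin + τ.nat .aMax) / 2 := ⟨_, rfl⟩
  simp only [block, List.foldr, runs_seq, runs_setN, NExp.eval, NExp.cost]
  refine (hM (n.choose 2 + 1 - m) _ (by omega) (by omega) (by simp [h₁]) (by simp [h₄])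
    (by simp [h₃, hm])).mono ?_
  rintro τ₁ t₁ ⟨ht₁, hz, hA, -, -, hB⟩
  have c₁ := hA .n (by simp)
  have c₂ := hA .k (by simp)
  have c₃ := hA .total (by simp)
  have c₄ := hB .alpha (by simp)
  have c₅ := hA .aMin (by simp)
  have c₆ := hA .aMax (by simp)
  have c₇ := hA .m (by simp)
  simp [← hm, h₁, h₂, h₃, h₄] at c₁ c₂ c₃ c₄ c₅ c₆ c₇
  refine (runs_feasibilityCheck c₁ c₂ c₄ rfl).frame.mono ?_
  rintro τ₂ t₂ ⟨hF, ht₂, hok, hfeas⟩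
  have d₁ := hF.nat .n (by simp [feasibilityCheck])
  have d₂ := hF.nat .k (by simp [feasibilityCheck])
  have d₃ := hF.nat .total (by simp [feasibilityCheck])
  have d₄ := hF.realArr .alpha (by simp [feasibilityCheck])
  have d₅ := hF.nat .aMin (by simp [feasibilityCheck])
  have d₆ := hF.nat .aMax (by simp [feasibilityCheck])
  have d₇ := hF.nat .m (by simp [feasibilityCheck])
  simp only [runs_cond, runs_setN, runs_skip, BExp.Holds, NExp.eval, BExp.cost, NExp.cost]
  constructor
  · intro h
    have hf := hfeas.1 (by omega)
    refine ⟨⟨?_, ?_, ?_, ?_, ?_, ?_, ?_, ?_, ?_⟩, by omega, ?_⟩ <;>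
      simp [d₁, d₂, d₃, d₄, d₅, d₇, c₁, c₂, c₃, c₄, c₅, c₇]
    · omega
    · omega
    · omega
    · intro x hx
      -- Two values of the same rank are equal, so the tested pivot is the only candidate the
      -- invariant speaks of.
      rw [le_antisymm (hz.anti hx le_rfl) (hx.anti hz le_rfl)]
      exact hf
    · exact h₉
    · omega
  · intro h
    have hf : ¬ greedyStart a n (τ₁.real .z) k = n := fun hc => by
      have := hfeas.2 hc
      omega
    refine ⟨⟨?_, ?_, ?_, ?_, ?_, ?_, ?_, ?_, ?_⟩, by omega, ?_⟩ <;>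
      simp [d₁, d₂, d₃, d₄, d₆, d₇, c₁, c₂, c₃, c₄, c₆, c₇]
    · omega
    · omega
    · exact h₈
    -- Here `m' ≤ m`, so the candidate `x` is at most the infeasible pivot; were it feasible, so
    -- would be the pivot.
    · intro m' hm₁ hm₂ x hx hg
      exact hf (greedyStart_eq_of_le_value hk hkn ha (hx.pos ha).le
        (hz.anti hx (by omega)) hg)
    · omega

theorem runs_minMaxKRange (ha : StrictMono (fun i : Fin n => a i)) (hk : 1 ≤ k) (hkn : k < n)
    (hM : SelectsWithin M a n T) {σ : State} (hn : σ.nat .n = n) (hσk : σ.nat .k = k)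
    (hσa : σ.realArr .alpha = a) :
    Runs (minMaxKRange M) σ (fun σ' t =>
      t ≤ (T + 31 * n + 60) * (n.choose 2).size + T + 53 * n + 60 ∧
      ∃ P : KPartition n k, P.IsOptimal (fun i : Fin n => a i) ∧ P.IsConsecutive ∧
        (∀ (j : Fin k) (i : Fin n), i ∈ P.S j ↔ σ'.natArr .label i = j) ∧
        σ'.real .z = P.maxRange (fun i : Fin n => a i)) := by
  have hN : 1 ≤ n.choose 2 := Nat.choose_pos (by omega)
  rw [minMaxKRange, block]
  simp only [List.foldr]
  rw [runs_seq]
  refine (runs_countPairs hn (by omega)).frame.mono ?_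
  rintro σ₁ t₁ ⟨hF, htot, ht₁⟩
  have c₁ := (hF.nat .n (by simp [countPairs])).trans hn
  have c₂ := (hF.nat .k (by simp [countPairs])).trans hσk
  have c₃ := (hF.realArr .alpha (by simp [countPairs])).trans hσa
  simp only [runs_seq, runs_setN, NExp.eval, NExp.cost]
  -- The potential is the cost bound of a round times the bit length of the gap between the two
  -- search bounds.
  refine (runs_loop (SearchInv a n k)
    (fun τ => (T + 31 * n + 60) * (τ.nat .aMax - τ.nat .aMin).size) ?_ ?_).mono ?_
  · intro τ hI hp
    refine (runs_searchStep ha hk hkn.le hM hI hp).mono ?_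
    rintro τ' t ⟨hI', ht, hd⟩
    refine ⟨hI', ?_⟩
    have hp' : τ.nat .aMin < τ.nat .aMax := hp
    have hs := Nat.mul_le_mul_left (T + 31 * n + 60) (size_add_one_le (by omega) hd)
    simp only [BExp.cost, NExp.cost]
    rw [mul_add] at hs
    omega
  · refine ⟨?_, ?_, ?_, ?_, ?_, ?_, ?_, ?_, ?_⟩ <;> simp [c₁, c₂, c₃, htot]
    · omega
    -- Initially `aMax` denotes the longest candidate, which is at least the full spread and
    -- therefore feasible with one interval.
    · intro x hx
      have hlt : (⟨0, by omega⟩ : Fin n) < ⟨n - 1, by omega⟩ := by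
        rw [Fin.lt_def]
        show 0 < n - 1
        omega
      obtain ⟨r, hr, -, hr'⟩ := exists_isNthLongest_sub (α := fun i : Fin n => a i) hlt
      exact greedyStart_eq_of_le (greedyStart_one ha (by omega) (hx.anti hr' hr)) hk
    · intro m h₁ h₂
      omega
  · rintro τ t ⟨hI, hp, ht⟩
    obtain ⟨h₁, h₂, h₃, h₄, h₅, h₆, h₇, h₈, h₉⟩ := hI
    simp only [BExp.Holds, NExp.eval, not_lt] at hp
    have heq : τ.nat .aMax = τ.nat .aMin := le_antisymm hp h₆
    simp [htot] at ht
    refine (hM (n.choose 2 + 1 - τ.nat .aMin) _ (by omega) (by omega) (by simp [h₁])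
      (by simp [h₄]) (by simp [h₃])).mono ?_
    rintro τ₁ t₂ ⟨ht₂, hz, hA, -, -, hB⟩
    have d₁ := hA .n (by simp)
    have d₂ := hA .k (by simp)
    have d₄ := hB .alpha (by simp)
    simp [h₁, h₂, h₄] at d₁ d₂ d₄
    refine (runs_writeClusters d₁ d₂ d₄ rfl hkn.le).mono ?_
    rintro τ₂ t₃ ⟨ht₃, hz', hlab⟩
    have hg := h₈ (τ₁.real .z) (by rw [heq]; exact hz)
    have hle := greedyPartition_maxRange_le hk hkn.le (hz.pos ha).le ha hg
    -- The value of `Q` is a candidate of some rank `r`, hence the `(N + 1 - r)`-th smallest. If it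
    -- were below the final `z`, that index would precede `aMin`, where every candidate is
    -- infeasible, whereas `Q` shows it feasible.
    have hopt : ∀ Q : KPartition n k, τ₁.real .z ≤ Q.maxRange (fun i : Fin n => a i) := by
      intro Q
      obtain ⟨x, y, hxy, hQ⟩ := Q.exists_lt_maxRange_eq hk hkn ha
      obtain ⟨r, hr₁, hr₂, hr⟩ := exists_isNthLongest_sub (α := fun i : Fin n => a i) hxy
      rw [← hQ] at hr
      by_contra hlt
      refine h₉ (n.choose 2 + 1 - r) (by omega) ?_ (Q.maxRange fun i : Fin n => a i) ?_
        (greedyStart_eq_of_partition hk ha Q le_rfl)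
      · by_contra hge
        exact hlt (hr.anti hz (by omega))
      · rwa [Nat.sub_sub_self (by omega)]
    have hval := le_antisymm (hopt (greedyPartition hkn.le hg)) hle
    simp only [runs_skip]
    refine ⟨?_, greedyPartition hkn.le hg, fun Q => hval ▸ hopt Q,
      blockPartition_isConsecutive _ _ _, fun j i => ?_, hz'.trans hval⟩
    · have := Nat.mul_le_mul_left (T + 31 * n + 60)
        (Nat.size_le_size (Nat.sub_le (n.choose 2) 1))
      omega
    · have hcov : ∀ j : Fin k, i ∈ (greedyPartition hkn.le hg).S j → τ₂.natArr .label i = j :=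
        fun j hj => hlab j j.2 i (mem_greedyPartition.1 hj).1 (mem_greedyPartition.1 hj).2
      refine ⟨hcov j, fun h => ?_⟩
      obtain ⟨j', hj'⟩ := (greedyPartition hkn.le hg).cover i
      have := hcov j' hj'
      rwa [show j = j' from Fin.ext (by omega)]

end search

theorem exists_minMaxKRange_bound {M : Cmd} (hM : IsPathSelector M) :
    ∃ C : ℝ, ∀ (n k : ℕ) (α : Fin n → ℝ) (σ : State),
      StrictMono α → 1 ≤ k → k < n → σ.HasScalars α → σ.nat .k = k →
      ∃ (σ' : State) (t : ℕ), Exec (minMaxKRange M) σ σ' t ∧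
        (t : ℝ) ≤ C * n * Real.log n ^ 3 ∧
        ∃ P : KPartition n k, P.IsOptimal α ∧ P.IsConsecutive ∧
          (∀ (j : Fin k) (i : Fin n), i ∈ P.S j ↔ σ'.natArr .label i = j) ∧
          σ'.real .z = P.maxRange α := by
  obtain ⟨C, hC⟩ := hM
  -- The factor 8 comes from `size N ≤ 2 * size n ≤ 8 * log n`, and the 2 from `1 ≤ 2 * log n`,
  -- which raises the terms outside the loop to the third power. The numbers 400 and 500 absorb
  -- linear and constant terms via `n ≤ 4 * n * log² n`. The absolute value is taken because nothing
  -- fixes the sign of `C`.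
  refine ⟨8 * (|C| + 400) + 2 * (|C| + 500), fun n k α σ hα hk hkn hσ hσk => ?_⟩
  obtain ⟨hn, hα'⟩ := hσ
  obtain rfl : α = fun i : Fin n => σ.realArr .alpha i := funext fun i => (hα' i).symm
  have hn2 : 2 ≤ n := by omega
  have hsel : SelectsWithin M (σ.realArr .alpha) n ⌊C * n * Real.log n ^ 2⌋₊ := by
    intro r τ hr₁ hr₂ hτn hτa hτr
    obtain ⟨τ', t, he, ht, hr, hA⟩ := hC n _ r τ hn2 hα hr₁ hr₂ ⟨hτn, fun i => by rw [hτa]⟩ hτr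
    exact ⟨τ', t, he, Nat.le_floor ht, hr, hA⟩
  obtain ⟨σ', t, he, ht, hP⟩ := runs_minMaxKRange hα hk hkn hsel hn hσk rfl
  refine ⟨σ', t, he, ?_, hP⟩
  set T := ⌊C * n * Real.log n ^ 2⌋₊
  set l := Real.log n 
  have hlog : 1 / 2 ≤ l := half_le_log hn2
  have hs : ((n.choose 2).size : ℝ) ≤ 8 * l := by
    have h₁ : ((n.choose 2).size : ℝ) ≤ 2 * n.size := by exact_mod_cast size_choose_two_le n
    linarith [size_le_log hn2]
  have hn1 : (1 : ℝ) ≤ n := by exact_mod_cast (by omega : 1 ≤ n)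
  have hnl : (n : ℝ) ≤ 4 * (n * l ^ 2) := by
    have : 1 / 4 ≤ l ^ 2 := by nlinarith
    nlinarith
  have hT : (T : ℝ) ≤ |C| * (n * l ^ 2) := by
    have h₀ : 0 ≤ (n : ℝ) * l ^ 2 := by positivity
    have h₁ : C * n * l ^ 2 ≤ |C| * (n * l ^ 2) := by
      rw [mul_assoc]
      exact mul_le_mul_of_nonneg_right (le_abs_self C) h₀
    exact (Nat.cast_le.2 (Nat.floor_le_floor h₁)).trans (Nat.floor_le (by positivity))
  have ht' : (t : ℝ) ≤ (T + 31 * n + 60) * (n.choose 2).size + (T + 53 * n + 60) := by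
    have : t ≤ (T + 31 * n + 60) * (n.choose 2).size + (T + 53 * n + 60) := by omega
    exact_mod_cast this
  have hX : 0 ≤ (n : ℝ) * l ^ 2 := by positivity
  have h₁ : (T + 31 * n + 60 : ℝ) ≤ (|C| + 400) * (n * l ^ 2) := by linarith
  have h₂ : (T + 53 * n + 60 : ℝ) ≤ (|C| + 500) * (n * l ^ 2) := by linarith
  have h₃ : (T + 31 * n + 60 : ℝ) * (n.choose 2).size ≤ (|C| + 400) * (n * l ^ 2) * (8 * l) :=
    mul_le_mul h₁ hs (by positivity) (by positivity)
  have h₄ : (|C| + 500) * (n * l ^ 2) * 1 ≤ (|C| + 500) * (n * l ^ 2) * (2 * l) :=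
    mul_le_mul_of_nonneg_left (by linarith) (by positivity)
  calc (t : ℝ) ≤ (|C| + 400) * (n * l ^ 2) * (8 * l) + (|C| + 500) * (n * l ^ 2) * (2 * l) := by
        linarith
    _ = (8 * (|C| + 400) + 2 * (|C| + 500)) * n * l ^ 3 := by ring

theorem exists_feasibilityCheck_bound :
    ∃ C : ℝ, ∀ (n k : ℕ) (α : Fin n → ℝ) (z : ℝ) (σ : State),
      StrictMono α → 1 ≤ k → k ≤ n → 0 ≤ z →
      σ.HasScalars α → σ.nat .k = k → σ.real .z = z →
      ∃ (σ' : State) (t : ℕ), Exec feasibilityCheck σ σ' t ∧ (t : ℝ) ≤ C * n ∧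
        (σ'.nat .ok = 0 ∨ σ'.nat .ok = 1) ∧
        (σ'.nat .ok = 1 ↔ ∃ P : KPartition n k, P.maxRange α ≤ z) := by
  refine ⟨51, fun n k α z σ hα hk hkn hz hσ hσk hσz => ?_⟩
  obtain ⟨hn, hα'⟩ := hσ
  obtain rfl : α = fun i : Fin n => σ.realArr .alpha i := funext fun i => (hα' i).symm
  obtain ⟨σ', t, he, ht, hok, hiff⟩ := runs_feasibilityCheck hn hσk rfl hσz
  refine ⟨σ', t, he, ?_, hok, hiff.trans (exists_partition_iff hk hkn hz hα).symm⟩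
  exact_mod_cast (by omega : t ≤ 51 * n)

/-! ### A selection program

The candidates are kept in rows: row `p` holds the values `α_q - α_p` with `lo[p] ≤ q < hi[p]` that
may still be the wanted one.  A round of the program determines a weighted median `z` of the middle
elements of the rows with the help of a tournament tree, finds the ranks of `z` by linear scans, and
discards at least a quarter of the remaining candidates. -/

notation "rowV" => NVar.tmp 0
notation "colV" => NVar.tmp 1
notation "nodeV" => NVar.tmp 2
notation "activeV" => NVar.tmp 3
notation "takenV" => NVar.tmp 4
notation "doneV" => NVar.tmp 5
notation "countV" => NVar.tmp 6
notation "loA" => NArr.tmp 0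
notation "hiA" => NArr.tmp 1
notation "winA" => NArr.tmp 2
notation "cutA" => NArr.tmp 3
notation "keyA" => RArr.tmp 0
notation "bigV" => RVar.tmp 0

/-- The weight `hi[p] - lo[p]` of the current row. -/
def rowWeight : NExp := .sub (.get hiA (.var rowV)) (.get loA (.var rowV))

/-- Make all candidates active. -/
def initRows : Cmd :=
  block
    [.setN rowV (.const 0),
     .loop (.natLt (.var rowV) (.var .n)) (block
       [.putN loA (.var rowV) (.add (.var rowV) (.const 1)),
        .putN hiA (.var rowV) (.var .n),
        .setN rowV (.add (.var rowV) (.const 1))])]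

/-- Compute the middle elements of the rows, the leaves of the tournament tree and the number of
active candidates.  The key of an empty row is larger than all candidates. -/
def loadKeys : Cmd :=
  block
    [.setR bigV (.add (.sub (.get .alpha (.sub (.var .n) (.const 1))) (.get .alpha (.const 0)))
       (.const 1)),
     .setN activeV (.const 0),
     .setN rowV (.const 0),
     .loop (.natLt (.var rowV) (.var .n)) (block
       [.setN activeV (.add (.var activeV) rowWeight),
        .putN winA (.add (.var .n) (.var rowV)) (.var rowV),
        .cond (.natLt (.get loA (.var rowV)) (.get hiA (.var rowV)))
          (.putR keyA (.var rowV)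
            (.sub (.get .alpha (.half (.add (.get loA (.var rowV)) (.get hiA (.var rowV)))))
              (.get .alpha (.var rowV))))
          (.putR keyA (.var rowV) (.var bigV)),
        .setN rowV (.add (.var rowV) (.const 1))])]

/-- Let the winners of the two children of the current node play against each other. -/
def playMatch : Cmd :=
  .cond (.realLe (.get keyA (.get winA (.add (.var nodeV) (.var nodeV))))
      (.get keyA (.get winA (.add (.add (.var nodeV) (.var nodeV)) (.const 1)))))
    (.putN winA (.var nodeV) (.get winA (.add (.var nodeV) (.var nodeV))))
    (.putN winA (.var nodeV) (.get winA (.add (.add (.var nodeV) (.var nodeV)) (.const 1))))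

/-- Play all matches, bottom-up. -/
def buildTree : Cmd :=
  block
    [.setN nodeV (.sub (.var .n) (.const 1)),
     .loop (.natLt (.const 0) (.var nodeV)) (block
       [playMatch,
        .setN nodeV (.sub (.var nodeV) (.const 1))])]

/-- Repeat the matches on the way from the current node to the root. -/
def climb : Cmd :=
  .loop (.natLt (.const 0) (.var nodeV)) (block
    [playMatch,
     .setN nodeV (.half (.var nodeV))])

/-- Take out the rows with the smallest keys, until they hold half of the active candidates.  The key
of the last one is left in `z`. -/
def findPivot : Cmd :=
  block
    [.setN takenV (.const 0),
     .loop (.natLt (.add (.var takenV) (.var takenV)) (.var activeV)) (block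
       [.setN rowV (.get winA (.const 1)),
        .setR .z (.get keyA (.var rowV)),
        .setN takenV (.add (.var takenV) rowWeight),
        .putR keyA (.var rowV) (.var bigV),
        .setN nodeV (.half (.add (.var .n) (.var rowV))),
        climb])]

/-- Find for each row the first column at which `test` fails, and count the columns from there on. -/
def scanRows (test : BExp) : Cmd :=
  block
    [.setN rowV (.const 0),
     .setN colV (.const 0),
     .setN countV (.const 0),
     .loop (.natLt (.var rowV) (.var .n))
       (.cond (.and (.natLt (.var colV) (.var .n)) test)
         (.setN colV (.add (.var colV) (.const 1)))
         (block
           [.putN cutA (.var rowV) (.var colV),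
            .setN countV (.add (.var countV) (.sub (.var .n) (.var colV))),
            .setN rowV (.add (.var rowV) (.const 1))]))]

/-- `lo[p] := max lo[p] cut[p]` for all rows. -/
def raiseLo : Cmd :=
  block
    [.setN rowV (.const 0),
     .loop (.natLt (.var rowV) (.var .n)) (block
       [.putN loA (.var rowV) (.add (.get loA (.var rowV))
          (.sub (.get cutA (.var rowV)) (.get loA (.var rowV)))),
        .setN rowV (.add (.var rowV) (.const 1))])]

/-- `hi[p] := min hi[p] cut[p]` for all rows. -/
def lowerHi : Cmd :=
  block
    [.setN rowV (.const 0),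
     .loop (.natLt (.var rowV) (.var .n)) (block
       [.putN hiA (.var rowV) (.sub (.get hiA (.var rowV))
          (.sub (.get hiA (.var rowV)) (.get cutA (.var rowV)))),
        .setN rowV (.add (.var rowV) (.const 1))])]

/-- `α_q - α_p ≤ z` for the current row `p` and column `q`. -/
def atMostPivot : BExp :=
  .realLe (.get .alpha (.var colV)) (.add (.get .alpha (.var rowV)) (.var .z))

/-- `α_q - α_p < z` for the current row `p` and column `q`. -/
def belowPivot : BExp :=
  .realLt (.get .alpha (.var colV)) (.add (.get .alpha (.var rowV)) (.var .z))

/-- Compare the wanted rank with the ranks of the pivot, and discard candidates accordingly. -/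
def discard : Cmd :=
  .seq (scanRows atMostPivot)
    (.cond (.natLe (.var .rank) (.var countV)) raiseLo
      (.seq (scanRows belowPivot)
        (.cond (.natLt (.var countV) (.var .rank)) lowerHi (.setN doneV (.const 1)))))

/-- The selection program. -/
def selectPath : Cmd :=
  block
    [initRows,
     .setN doneV (.const 0),
     .loop (.natLt (.var doneV) (.const 1)) (block [loadKeys, buildTree, findPivot, discard])]

/-! ### The tournament tree -/

/-- The winner at node `u` has a key no larger than the winners at its children. -/
def MatchOK (key : ℕ → ℝ) (win : ℕ → ℕ) (u : ℕ) : Prop :=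
  key (win u) ≤ key (win (2 * u)) ∧ key (win u) ≤ key (win (2 * u + 1))

/-- The winner at node `u` is one of the leaves below `u`. -/
def WinnerBelow (n : ℕ) (win : ℕ → ℕ) (u : ℕ) : Prop :=
  win u < n ∧ ∃ i, u = (n + win u) / 2 ^ i

/-- Keys do not increase from a node `v` to its parent `v / 2`, and halving leads every node to the
root. -/
theorem key_root_le {key : ℕ → ℝ} {win : ℕ → ℕ} {n : ℕ}
    (h : ∀ u, 1 ≤ u → u < n → MatchOK key win u) {v : ℕ} (h₁ : 1 ≤ v) (h₂ : v < 2 * n) :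
    key (win 1) ≤ key (win v) := by
  induction v using Nat.strong_induction_on with
  | _ v ih =>
    rcases h₁.eq_or_lt with rfl | h₁
    · exact le_rfl
    · have hm := h (v / 2) (by omega) (by omega)
      refine (ih (v / 2) (by omega) (by omega) (by omega)).trans ?_
      rcases Nat.mod_two_eq_zero_or_one v with hv | hv
      · rw [show v = 2 * (v / 2) by omega]
        simpa using hm.1
      · have := hm.2
        rwa [show 2 * (v / 2) + 1 = v by omega] at this

theorem WinnerBelow.of_child {n : ℕ} {win : ℕ → ℕ} {c v w : ℕ} (h : WinnerBelow n win c)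
    (hc : c / 2 = v) (hw : w = win c) : WinnerBelow n (Function.update win v w) v := by
  obtain ⟨h₁, i, hi⟩ := h
  simp only [WinnerBelow, Function.update_self, hw]
  refine ⟨h₁, i + 1, ?_⟩
  rw [pow_succ, ← Nat.div_div_eq_div_mul, ← hi, hc]

theorem MatchOK.update_win {key : ℕ → ℝ} {win : ℕ → ℕ} {u v w : ℕ} (h : MatchOK key win u)
    (hu : u ≠ v) (hv : u ≠ v / 2) : MatchOK key (Function.update win v w) u := by
  unfold MatchOK
  rw [Function.update_of_ne hu, Function.update_of_ne (by omega), Function.update_of_ne (by omega)]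
  exact h

theorem matchOK_update_self {key : ℕ → ℝ} {win : ℕ → ℕ} {v w : ℕ} (hv : 1 ≤ v)
    (h₁ : key w ≤ key (win (2 * v))) (h₂ : key w ≤ key (win (2 * v + 1))) :
    MatchOK key (Function.update win v w) v := by
  unfold MatchOK
  rw [Function.update_self, Function.update_of_ne (by omega), Function.update_of_ne (by omega)]
  exact ⟨h₁, h₂⟩

/-- Raising the key of a leaf can invalidate only matches that this leaf won; elsewhere the losing
side can only grow. -/
theorem MatchOK.update_key {key : ℕ → ℝ} {win : ℕ → ℕ} {u p : ℕ} {b : ℝ} (h : MatchOK key win u)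
    (hu : win u ≠ p) (hb : key p ≤ b) : MatchOK (Function.update key p b) win u := by
  have hle : ∀ q, key q ≤ Function.update key p b q := by
    intro q
    rw [Function.update_apply]
    split_ifs with hq
    · rwa [hq]
    · exact le_rfl
  unfold MatchOK
  rw [Function.update_of_ne hu]
  exact ⟨h.1.trans (hle _), h.2.trans (hle _)⟩

theorem WinnerBelow.update {n : ℕ} {win : ℕ → ℕ} {u v w : ℕ} (h : WinnerBelow n win u)
    (hu : u ≠ v) : WinnerBelow n (Function.update win v w) u := by
  unfold WinnerBelow
  rw [Function.update_of_ne hu]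
  exact h

theorem runs_playMatch {τ : State} {v : ℕ} {win : ℕ → ℕ} {key : ℕ → ℝ} (hv : τ.nat nodeV = v)
    (hw : τ.natArr winA = win) (hk : τ.realArr keyA = key) :
    Runs playMatch τ (fun τ' t => t ≤ 23 ∧ ∃ w, τ'.natArr winA = Function.update win v w ∧
      (w = win (2 * v) ∨ w = win (2 * v + 1)) ∧
      key w ≤ key (win (2 * v)) ∧ key w ≤ key (win (2 * v + 1))) := by
  simp only [playMatch, runs_cond, runs_putN, BExp.Holds, RExp.eval, NExp.eval, BExp.cost,
    RExp.cost, NExp.cost, State.putN_natArr, if_true, hv, hw, hk, ← two_mul]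
  refine ⟨fun h => ⟨by omega, _, rfl, .inl rfl, le_rfl, h⟩,
    fun h => ⟨by omega, _, rfl, .inr rfl, (not_le.1 h).le, le_rfl⟩⟩

/-- All leaves are in place, and every winner is one of the leaves below its node. -/
structure LeavesOK (n : ℕ) (win : ℕ → ℕ) : Prop where
  leaf : ∀ p < n, win (n + p) = p
  below : ∀ u, 1 ≤ u → u < 2 * n → WinnerBelow n win u

theorem runs_buildTree {σ : State} {n : ℕ} {key : ℕ → ℝ} (hn : σ.nat .n = n) (h1 : 1 ≤ n)
    (hk : σ.realArr keyA = key) (hl : ∀ p < n, σ.natArr winA (n + p) = p) :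
    Runs buildTree σ (fun σ' t => t ≤ 40 * n + 20 ∧ LeavesOK n (σ'.natArr winA) ∧
      ∀ u, 1 ≤ u → u < n → MatchOK key (σ'.natArr winA) u) := by
  simp only [buildTree, block, List.foldr, runs_seq, runs_setN, NExp.eval, NExp.cost]
  refine (runs_loop_frame _
    (fun τ => τ.nat nodeV < n ∧ (∀ p < n, τ.natArr winA (n + p) = p) ∧
      (∀ u, τ.nat nodeV < u → u < 2 * n → WinnerBelow n (τ.natArr winA) u) ∧
      (∀ u, τ.nat nodeV < u → u < n → MatchOK key (τ.natArr winA) u))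
    (fun τ => 40 * τ.nat nodeV) ?_ ?_).mono ?_
  · simp only [State.setN_nat, if_true, State.setN_natArr, hn]
    refine ⟨by omega, hl, fun u h₁ h₂ => ?_, fun u h₁ h₂ => by omega⟩
    obtain ⟨p, rfl⟩ : ∃ p, u = n + p := ⟨u - n, by omega⟩
    have := hl p (by omega)
    exact ⟨by omega, 0, by rw [this]; simp⟩
  · rintro τ hF ⟨h₁, h₂, h₃, h₄⟩ hp
    have e₁ := hF.realArr keyA (by simp [playMatch])
    simp only [State.setN_realArr, hk] at e₁
    simp only [BExp.Holds, NExp.eval] at hp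
    simp only [runs_seq]
    refine (runs_playMatch rfl rfl e₁).frame.mono ?_
    rintro τ' t ⟨hF', ht, w, hw, hw', hw₁, hw₂⟩
    have f₁ := hF'.nat nodeV (by simp [playMatch])
    simp only [runs_setN, runs_skip, NExp.eval, NExp.cost, State.setN_nat, if_true,
      State.setN_natArr, hw, f₁, BExp.cost]
    refine ⟨⟨by omega, fun p hp => ?_, fun u hu hu' => ?_, fun u hu hu' => ?_⟩, by omega⟩
    · rw [Function.update_of_ne (by omega)]
      exact h₂ p hp
    · by_cases huv : u = τ.nat nodeV
      · rw [huv]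
        rcases hw' with hw' | hw'
        · exact (h₃ (2 * τ.nat nodeV) (by omega) (by omega)).of_child (by omega) hw'
        · exact (h₃ (2 * τ.nat nodeV + 1) (by omega) (by omega)).of_child (by omega) hw'
      · exact (h₃ u (by omega) hu').update huv
    · by_cases huv : u = τ.nat nodeV
      · rw [huv]
        exact matchOK_update_self (by omega) hw₁ hw₂
      · exact (h₄ u (by omega) hu').update_win huv (by omega)
  · rintro τ t ⟨hF, ⟨h₁, h₂, h₃, h₄⟩, hp, ht⟩
    simp only [BExp.Holds, NExp.eval] at hp
    simp [hn] at ht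
    simp only [runs_skip]
    exact ⟨by omega, ⟨h₂, fun u hu => h₃ u (by omega)⟩, fun u hu => h₄ u (by omega)⟩

/-- Only the nodes `v / 2 ^ i` may hold an outdated result. Replaying the match at `v` leaves only
its proper ancestors in doubt, and there are at most `size v` nodes on the way up. -/
theorem runs_climb {σ : State} {n v : ℕ} {key : ℕ → ℝ} (hk : σ.realArr keyA = key)
    (hv : σ.nat nodeV = v) (hvn : v < n) (hl : LeavesOK n (σ.natArr winA))
    (hm : ∀ u, 1 ≤ u → u < n → (∀ i, u ≠ v / 2 ^ i) → MatchOK key (σ.natArr winA) u) :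
    Runs climb σ (fun σ' t => t ≤ 40 * n.size + 10 ∧ LeavesOK n (σ'.natArr winA) ∧
      ∀ u, 1 ≤ u → u < n → MatchOK key (σ'.natArr winA) u) := by
  refine (runs_loop_frame σ
    (fun τ => τ.nat nodeV < n ∧ LeavesOK n (τ.natArr winA) ∧
      ∀ u, 1 ≤ u → u < n → (∀ i, u ≠ τ.nat nodeV / 2 ^ i) → MatchOK key (τ.natArr winA) u)
    (fun τ => 40 * (τ.nat nodeV).size) ⟨by omega, hl, by rwa [hv]⟩ ?_).mono ?_
  · rintro τ hF ⟨h₁, h₂, h₃⟩ hp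
    have e₁ := hF.realArr keyA (by simp [playMatch])
    rw [hk] at e₁
    simp only [BExp.Holds, NExp.eval] at hp
    simp only [block, List.foldr, runs_seq]
    refine (runs_playMatch rfl rfl e₁).frame.mono ?_
    rintro τ' t ⟨hF', ht, w, hw, hw', hw₁, hw₂⟩
    have f₁ := hF'.nat nodeV (by simp [playMatch])
    have hs := size_add_one_le hp (le_refl (τ.nat nodeV / 2))
    simp only [runs_setN, runs_skip, NExp.eval, NExp.cost, State.setN_nat, if_true,
      State.setN_natArr, hw, f₁, BExp.cost]
    refine ⟨⟨by omega, ⟨fun p hp => ?_, fun u hu hu' => ?_⟩, fun u hu hu' hne => ?_⟩, by omega⟩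
    · rw [Function.update_of_ne (by omega)]
      exact h₂.leaf p hp
    · by_cases huv : u = τ.nat nodeV
      · rw [huv]
        rcases hw' with hw' | hw'
        · exact (h₂.below (2 * τ.nat nodeV) (by omega) (by omega)).of_child (by omega) hw'
        · exact (h₂.below (2 * τ.nat nodeV + 1) (by omega) (by omega)).of_child (by omega) hw'
      · exact (h₂.below u hu hu').update huv
    · by_cases huv : u = τ.nat nodeV
      · rw [huv]
        exact matchOK_update_self (by omega) hw₁ hw₂
      -- A new winner at the current node affects, besides that node, only the match at its parent,
      -- which is still on the path.
      · refine (h₃ u hu hu' fun i => ?_).update_win huv (by simpa using hne 0)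
        cases i with
        | zero => simpa using huv
        | succ i =>
          rw [pow_succ', ← Nat.div_div_eq_div_mul]
          exact hne i
  · rintro τ t ⟨hF, ⟨h₁, h₂, h₃⟩, hp, ht⟩
    simp only [BExp.Holds, NExp.eval] at hp
    have hs : (σ.nat nodeV).size ≤ n.size := Nat.size_le_size (by omega)
    simp only [BExp.cost, NExp.cost] at ht
    refine ⟨by omega, h₂, fun u hu hu' => h₃ u hu hu' fun i => ?_⟩
    have : τ.nat nodeV = 0 := by omega
    rw [this, Nat.zero_div]
    omega

/-! ### Linear passes over the rows -/

theorem runs_initRows {σ : State} {n : ℕ} (hn : σ.nat .n = n) :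
    Runs initRows σ (fun σ' t => t ≤ 20 * n + 10 ∧
      ∀ p < n, σ'.natArr loA p = p + 1 ∧ σ'.natArr hiA p = n) := by
  simp only [initRows, block, List.foldr, runs_seq, runs_setN, NExp.eval, NExp.cost]
  refine (runs_loop_frame _
    (fun τ => τ.nat rowV ≤ n ∧ ∀ p < τ.nat rowV, τ.natArr loA p = p + 1 ∧ τ.natArr hiA p = n)
    (fun τ => 20 * (n - τ.nat rowV)) (by simp) ?_).mono ?_
  · rintro τ hF ⟨h₁, h₂⟩ hp
    have e₁ := hF.nat .n (by simp)
    simp at e₁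
    simp only [BExp.Holds, NExp.eval, e₁, hn] at hp
    simp [e₁, hn]
    refine ⟨⟨by omega, fun p hp' => ?_⟩, by omega⟩
    rcases hp'.lt_or_eq with h | h
    · rw [Function.update_of_ne (by omega), Function.update_of_ne (by omega)]
      exact h₂ p h
    · simp [h]
  · rintro τ t ⟨hF, ⟨h₁, h₂⟩, hp, ht⟩
    have e₁ := hF.nat .n (by simp)
    simp at e₁
    simp only [BExp.Holds, NExp.eval, e₁, hn] at hp
    simp at ht
    simp only [runs_skip]
    exact ⟨by omega, fun p hp => h₂ p (by omega)⟩

theorem runs_raiseLo {σ : State} {n : ℕ} {lo cut : ℕ → ℕ} (hn : σ.nat .n = n)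
    (hlo : σ.natArr loA = lo) (hcut : σ.natArr cutA = cut) :
    Runs raiseLo σ (fun σ' t => t ≤ 20 * n + 10 ∧
      ∀ p < n, σ'.natArr loA p = max (lo p) (cut p)) := by
  simp only [raiseLo, block, List.foldr, runs_seq, runs_setN, NExp.eval, NExp.cost]
  refine (runs_loop_frame _
    (fun τ => τ.nat rowV ≤ n ∧ (∀ p < τ.nat rowV, τ.natArr loA p = max (lo p) (cut p)) ∧
      ∀ p, τ.nat rowV ≤ p → τ.natArr loA p = lo p)
    (fun τ => 20 * (n - τ.nat rowV)) (by simp [hlo]) ?_).mono ?_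
  · rintro τ hF ⟨h₁, h₂, h₃⟩ hp
    have e₁ := hF.nat .n (by simp)
    have e₂ := hF.natArr cutA (by simp)
    simp at e₁ e₂
    simp only [BExp.Holds, NExp.eval, e₁, hn] at hp
    simp [e₂, hcut]
    refine ⟨⟨by omega, fun p hp' => ?_, fun p hp' => ?_⟩, by omega⟩
    · rcases hp'.lt_or_eq with h | h
      · rw [Function.update_of_ne (by omega)]
        exact h₂ p h
      -- With truncated subtraction, `lo + (cut - lo)` is the maximum of the two.
      · rw [h, Function.update_self, h₃ _ le_rfl]
        omega
    · rw [Function.update_of_ne (by omega)]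
      exact h₃ p (by omega)
  · rintro τ t ⟨hF, ⟨h₁, h₂, h₃⟩, hp, ht⟩
    have e₁ := hF.nat .n (by simp)
    simp at e₁
    simp only [BExp.Holds, NExp.eval, e₁, hn] at hp
    simp at ht
    simp only [runs_skip]
    exact ⟨by omega, fun p hp => h₂ p (by omega)⟩

theorem runs_lowerHi {σ : State} {n : ℕ} {hi cut : ℕ → ℕ} (hn : σ.nat .n = n)
    (hhi : σ.natArr hiA = hi) (hcut : σ.natArr cutA = cut) :
    Runs lowerHi σ (fun σ' t => t ≤ 20 * n + 10 ∧
      ∀ p < n, σ'.natArr hiA p = min (hi p) (cut p)) := by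
  simp only [lowerHi, block, List.foldr, runs_seq, runs_setN, NExp.eval, NExp.cost]
  refine (runs_loop_frame _
    (fun τ => τ.nat rowV ≤ n ∧ (∀ p < τ.nat rowV, τ.natArr hiA p = min (hi p) (cut p)) ∧
      ∀ p, τ.nat rowV ≤ p → τ.natArr hiA p = hi p)
    (fun τ => 20 * (n - τ.nat rowV)) (by simp [hhi]) ?_).mono ?_
  · rintro τ hF ⟨h₁, h₂, h₃⟩ hp
    have e₁ := hF.nat .n (by simp)
    have e₂ := hF.natArr cutA (by simp)
    simp at e₁ e₂
    simp only [BExp.Holds, NExp.eval, e₁, hn] at hp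
    simp [e₂, hcut]
    refine ⟨⟨by omega, fun p hp' => ?_, fun p hp' => ?_⟩, by omega⟩
    · rcases hp'.lt_or_eq with h | h
      · rw [Function.update_of_ne (by omega)]
        exact h₂ p h
      -- With truncated subtraction, `hi - (hi - cut)` is the minimum of the two.
      · rw [h, Function.update_self, h₃ _ le_rfl]
        omega
    · rw [Function.update_of_ne (by omega)]
      exact h₃ p (by omega)
  · rintro τ t ⟨hF, ⟨h₁, h₂, h₃⟩, hp, ht⟩
    have e₁ := hF.nat .n (by simp)
    simp at e₁
    simp only [BExp.Holds, NExp.eval, e₁, hn] at hp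
    simp at ht
    simp only [runs_skip]
    exact ⟨by omega, fun p hp => h₂ p (by omega)⟩

/-- The scan stays in the lower left part of the matrix of candidates, where `D` holds. -/
theorem runs_scanRows {σ : State} {n : ℕ} {a : ℕ → ℝ} {z : ℝ} {test : BExp} {D : ℕ → ℕ → Prop}
    (hn : σ.nat .n = n) (ha : σ.realArr .alpha = a) (hz : σ.real .z = z) (hc : test.cost ≤ 10)
    (htest : ∀ τ : State, τ.realArr .alpha = a → τ.real .z = z →
      (test.Holds τ ↔ D (τ.nat rowV) (τ.nat colV)))
    (hD : ∀ p q, p + 1 < n → D p q → D (p + 1) q) :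
    Runs (scanRows test) σ (fun σ' t => t ≤ 80 * n + 20 ∧
      σ'.nat countV = ∑ p ∈ Finset.range n, (n - σ'.natArr cutA p) ∧
      ∀ p < n, σ'.natArr cutA p ≤ n ∧ (∀ q < σ'.natArr cutA p, D p q) ∧
        (σ'.natArr cutA p < n → ¬ D p (σ'.natArr cutA p))) := by
  simp only [scanRows, block, List.foldr, runs_seq, runs_setN, NExp.eval, NExp.cost]
  -- A staircase walk: every pass advances the row or the column, so at most `2 * n` passes occur.
  -- By `hD` the columns already accepted remain accepted in the next row, and the column pointer
  -- need not move back.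
  refine (runs_loop_frame _
    (fun τ => τ.nat rowV ≤ n ∧ τ.nat colV ≤ n ∧
      (τ.nat rowV < n → ∀ q < τ.nat colV, D (τ.nat rowV) q) ∧
      τ.nat countV = ∑ p ∈ Finset.range (τ.nat rowV), (n - τ.natArr cutA p) ∧
      ∀ p < τ.nat rowV, τ.natArr cutA p ≤ n ∧ (∀ q < τ.natArr cutA p, D p q) ∧
        (τ.natArr cutA p < n → ¬ D p (τ.natArr cutA p)))
    (fun τ => 40 * (2 * n - τ.nat rowV - τ.nat colV)) (by simp) ?_).mono ?_
  · rintro τ hF ⟨h₁, h₂, h₃, h₄, h₅⟩ hp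
    have e₁ := hF.nat .n (by simp)
    have e₂ := hF.realArr .alpha (by simp)
    have e₃ := hF.real .z (by simp)
    simp [hn, ha, hz] at e₁ e₂ e₃
    simp only [BExp.Holds, NExp.eval, e₁] at hp
    have ht := htest τ e₂ e₃
    rw [runs_cond]
    simp only [BExp.Holds, NExp.eval, e₁, ht]
    constructor
    · rintro ⟨hq, hd⟩
      simp
      refine ⟨⟨by omega, by omega, fun _ q hq' => ?_, h₄, h₅⟩, by omega⟩
      rcases hq'.lt_or_eq with h | h
      · exact h₃ hp q h
      · rwa [h]
    · intro hne
      simp [e₁]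
      refine ⟨⟨by omega, by omega, fun h q hq' => hD _ _ h (h₃ hp q hq'), ?_, fun p hp' => ?_⟩,
        by omega⟩
      · rw [Finset.sum_range_succ, Function.update_self, h₄]
        congr 1
        refine Finset.sum_congr rfl fun p hp' => ?_
        rw [Function.update_of_ne (Finset.mem_range.1 hp').ne]
      · rcases hp'.lt_or_eq with h | h
        · rw [Function.update_of_ne (by omega)]
          exact h₅ p h
        · rw [h, Function.update_self]
          exact ⟨h₂, h₃ hp, fun h hd => hne ⟨h, hd⟩⟩
  · rintro τ t ⟨hF, ⟨h₁, h₂, h₃, h₄, h₅⟩, hp, ht⟩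
    have e₁ := hF.nat .n (by simp)
    simp [hn] at e₁
    simp only [BExp.Holds, NExp.eval, e₁] at hp
    simp at ht
    have : τ.nat rowV = n := by omega
    rw [this] at h₄ h₅
    simp only [runs_skip]
    exact ⟨by omega, h₄, h₅⟩

/-- The middle element of row `p`, or `big` if the row is empty. -/
noncomputable def rowKey (a : ℕ → ℝ) (lo hi : ℕ → ℕ) (big : ℝ) (p : ℕ) : ℝ :=
  if lo p < hi p then a ((lo p + hi p) / 2) - a p else big

theorem runs_loadKeys {σ : State} {n : ℕ} {a : ℕ → ℝ} {lo hi : ℕ → ℕ} (hn : σ.nat .n = n)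
    (ha : σ.realArr .alpha = a) (hlo : σ.natArr loA = lo) (hhi : σ.natArr hiA = hi) :
    Runs loadKeys σ (fun σ' t => t ≤ 60 * n + 30 ∧ σ'.real bigV = a (n - 1) - a 0 + 1 ∧
      σ'.nat activeV = ∑ p ∈ Finset.range n, (hi p - lo p) ∧
      (∀ p < n, σ'.natArr winA (n + p) = p) ∧
      ∀ p < n, σ'.realArr keyA p = rowKey a lo hi (a (n - 1) - a 0 + 1) p) := by
  simp only [loadKeys, block, List.foldr, runs_seq, runs_setN, runs_setR, NExp.eval, NExp.cost,
    RExp.eval, RExp.cost]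
  refine (runs_loop_frame _
    (fun τ => τ.nat rowV ≤ n ∧
      τ.nat activeV = ∑ p ∈ Finset.range (τ.nat rowV), (hi p - lo p) ∧
      (∀ p < τ.nat rowV, τ.natArr winA (n + p) = p) ∧
      ∀ p < τ.nat rowV, τ.realArr keyA p = rowKey a lo hi (a (n - 1) - a 0 + 1) p)
    (fun τ => 60 * (n - τ.nat rowV)) (by simp) ?_).mono ?_
  · rintro τ hF ⟨h₁, h₂, h₃, h₄⟩ hp
    have e₁ := hF.nat .n (by simp)
    have e₂ := hF.realArr .alpha (by simp)
    have e₃ := hF.real bigV (by simp)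
    have e₄ := hF.natArr loA (by simp)
    have e₅ := hF.natArr hiA (by simp)
    simp [hn, ha, hlo, hhi] at e₁ e₂ e₃ e₄ e₅
    simp only [BExp.Holds, NExp.eval, e₁] at hp
    have hwin : ∀ p < τ.nat rowV + 1,
        Function.update (τ.natArr winA) (n + τ.nat rowV) (τ.nat rowV) (n + p) = p := by
      intro p hp'
      rcases (Nat.lt_succ_iff_lt_or_eq.1 hp') with h | h
      · rw [Function.update_of_ne (by omega)]
        exact h₃ p h
      · rw [h, Function.update_self]
    have hkey : ∀ p < τ.nat rowV + 1, Function.update (τ.realArr keyA) (τ.nat rowV)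
        (rowKey a lo hi (a (n - 1) - a 0 + 1) (τ.nat rowV)) p =
          rowKey a lo hi (a (n - 1) - a 0 + 1) p := by
      intro p hp'
      rcases (Nat.lt_succ_iff_lt_or_eq.1 hp') with h | h
      · rw [Function.update_of_ne (by omega)]
        exact h₄ p h
      · rw [h, Function.update_self]
    have hsum : τ.nat activeV + (hi (τ.nat rowV) - lo (τ.nat rowV)) =
        ∑ p ∈ Finset.range (τ.nat rowV + 1), (hi p - lo p) := by
      rw [Finset.sum_range_succ, h₂]
    simp only [runs_seq, runs_setN, runs_putN, runs_cond, runs_putR, runs_skip, rowWeight,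
      NExp.eval, RExp.eval, BExp.Holds, NExp.cost, RExp.cost, BExp.cost]
    simp only [State.setN_nat, State.setN_natArr, State.setN_realArr, State.putN_nat,
      State.putN_natArr, State.putN_realArr, State.putR_nat, State.putR_natArr, State.putR_realArr,
      State.setN_real, State.putN_real,
      if_true, e₁, e₂, e₃, e₄, e₅, NVar.tmp.injEq, NArr.tmp.injEq,
      reduceCtorEq, if_false, Nat.reduceEqDiff, hsum]
    constructor
    · intro h
      have hk : a ((lo (τ.nat rowV) + hi (τ.nat rowV)) / 2) - a (τ.nat rowV) =
          rowKey a lo hi (a (n - 1) - a 0 + 1) (τ.nat rowV) := by rw [rowKey, if_pos h]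
      rw [hk]
      exact ⟨⟨by omega, trivial, hwin, hkey⟩, by omega⟩
    · intro h
      have hk : a (n - 1) - a 0 + 1 =
          rowKey a lo hi (a (n - 1) - a 0 + 1) (τ.nat rowV) := by rw [rowKey, if_neg h]
      refine ⟨⟨by omega, trivial, hwin, fun p hp' => ?_⟩, by omega⟩
      rw [← hkey p hp', ← hk]
  · rintro τ t ⟨hF, ⟨h₁, h₂, h₃, h₄⟩, hp, ht⟩
    have e₁ := hF.nat .n (by simp)
    have e₃ := hF.real bigV (by simp)
    simp [hn, ha] at e₁ e₃
    simp only [BExp.Holds, NExp.eval, e₁] at hp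
    simp at ht
    have : τ.nat rowV = n := by omega
    rw [this] at h₂ h₃ h₄
    simp only [runs_skip]
    exact ⟨by omega, e₃, h₂, h₃, h₄⟩

/-! ### The weighted median of the row middles -/

/-- `z` is one of the keys `K p`, `p < n`, with positive weight, and both the keys `≤ z` and the keys
`≥ z` have at least half of the total weight. -/
structure IsWeightedMedian (n : ℕ) (w : ℕ → ℕ) (K : ℕ → ℝ) (z : ℝ) : Prop where
  mem : ∃ p < n, 0 < w p ∧ z = K p
  lower : ∃ R ⊆ Finset.range n,
    ∑ p ∈ Finset.range n, w p ≤ 2 * ∑ p ∈ R, w p ∧ ∀ p ∈ R, K p ≤ z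
  upper : ∃ U ⊆ Finset.range n,
    ∑ p ∈ Finset.range n, w p ≤ 2 * ∑ p ∈ U, w p ∧ ∀ p ∈ U, z ≤ K p

/-- The rows in `R` have been taken out of the tournament. -/
structure TournamentInv (n : ℕ) (w : ℕ → ℕ) (K : ℕ → ℝ) (big : ℝ) (R : Finset ℕ) (τ : State) :
    Prop where
  subset : R ⊆ Finset.range n
  taken : τ.nat takenV = ∑ p ∈ R, w p
  key_mem : ∀ p ∈ R, τ.realArr keyA p = big
  key_notMem : ∀ p < n, p ∉ R → τ.realArr keyA p = K p
  leaves : LeavesOK n (τ.natArr winA)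
  matches_ok : ∀ u, 1 ≤ u → u < n → MatchOK (τ.realArr keyA) (τ.natArr winA) u
  sorted : ∀ p ∈ R, ∀ q < n, q ∉ R → K p ≤ K q
  pivot : R.Nonempty → (∃ p < n, 0 < w p ∧ τ.real .z = K p) ∧ (∀ p ∈ R, K p ≤ τ.real .z) ∧
    ∃ U ⊆ Finset.range n,
      ∑ p ∈ Finset.range n, w p ≤ 2 * ∑ p ∈ U, w p ∧ ∀ p ∈ U, τ.real .z ≤ K p

open Classical in
/-- The number of rows that are still in the tournament. -/
noncomputable def numRemaining (n : ℕ) (big : ℝ) (key : ℕ → ℝ) : ℕ :=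
  ((Finset.range n).filter (fun p => key p < big)).card

theorem numRemaining_update {n : ℕ} {big : ℝ} {key : ℕ → ℝ} {p : ℕ} (hp : p < n)
    (hk : key p < big) : numRemaining n big (Function.update key p big) + 1 ≤
      numRemaining n big key := by
  classical
  have hmem : p ∈ (Finset.range n).filter (fun p => key p < big) :=
    Finset.mem_filter.2 ⟨Finset.mem_range.2 hp, hk⟩
  have hsub : (Finset.range n).filter (fun q => Function.update key p big q < big) ⊆
      ((Finset.range n).filter (fun p => key p < big)).erase p := by
    intro q hq
    rw [Finset.mem_filter] at hq
    have hqp : q ≠ p := by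
      rintro rfl
      simp at hq
    rw [Function.update_of_ne hqp] at hq
    exact Finset.mem_erase.2 ⟨hqp, Finset.mem_filter.2 hq⟩
  have h₁ := Finset.card_le_card hsub
  have h₂ := Finset.card_erase_add_one hmem
  unfold numRemaining
  omega

/-- Rows leave the tournament in order of increasing keys, so the last key `z` bounds all removed
ones from above, and these hold at least half of the weight. Just before the last removal the rows
still present held more than half, and `z` was the least key among them. -/
theorem runs_findPivot {σ : State} {n : ℕ} {lo hi : ℕ → ℕ} {K : ℕ → ℝ} {big : ℝ}
    (hn : σ.nat .n = n) (h1 : 1 ≤ n) (hlo : σ.natArr loA = lo) (hhi : σ.natArr hiA = hi)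
    (hbig : σ.real bigV = big)
    (hA : σ.nat activeV = ∑ p ∈ Finset.range n, (hi p - lo p))
    (hApos : 0 < ∑ p ∈ Finset.range n, (hi p - lo p))
    (hkey : ∀ p < n, σ.realArr keyA p = K p)
    (hK : ∀ p < n, K p ≤ big ∧ (K p < big ↔ 0 < hi p - lo p))
    (hl : LeavesOK n (σ.natArr winA))
    (hm : ∀ u, 1 ≤ u → u < n → MatchOK (σ.realArr keyA) (σ.natArr winA) u) :
    Runs findPivot σ (fun σ' t => t ≤ (40 * n.size + 60) * n + 20 ∧
      IsWeightedMedian n (fun p => hi p - lo p) K (σ'.real .z)) := by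
  set w : ℕ → ℕ := fun p => hi p - lo p with hw
  simp only [findPivot, block, List.foldr, runs_seq, runs_setN, NExp.eval, NExp.cost]
  refine (runs_loop_frame _ (fun τ => ∃ R, TournamentInv n w K big R τ)
    (fun τ => (40 * n.size + 60) * numRemaining n big (τ.realArr keyA)) ?_ ?_).mono ?_
  · refine ⟨∅, ⟨?_, ?_, ?_, ?_, ?_, ?_, ?_, ?_⟩⟩ <;> simp
    · exact hkey
    · exact hl
    · exact hm
  · rintro τ hF ⟨R, hI⟩ hp
    have e₁ := hF.nat .n (by simp [climb, playMatch])
    have e₂ := hF.nat activeV (by simp [climb, playMatch])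
    have e₃ := hF.real bigV (by simp [climb, playMatch])
    have e₄ := hF.natArr loA (by simp [climb, playMatch])
    have e₅ := hF.natArr hiA (by simp [climb, playMatch])
    simp [hn, hA, hlo, hhi, hbig] at e₁ e₂ e₃ e₄ e₅
    simp only [BExp.Holds, NExp.eval, e₂, hI.taken] at hp
    have hsplit := Finset.sum_sdiff (f := w) hI.subset
    have hp' : 2 * ∑ p ∈ R, w p < ∑ p ∈ Finset.range n, w p := by
      rw [two_mul]
      exact hp
    -- Less than half is taken, so a row of positive weight is left. Its key is below `big`, hence
    -- the root is a genuine row as well.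
    obtain ⟨x, hx, hwx⟩ : ∃ x ∈ Finset.range n \ R, w x ≠ 0 :=
      Finset.exists_ne_zero_of_sum_ne_zero (by omega)
    rw [Finset.mem_sdiff, Finset.mem_range] at hx
    obtain ⟨p, hpdef⟩ : ∃ p, p = τ.natArr winA 1 := ⟨_, rfl⟩
    have hpn : p < n := by
      rw [hpdef]
      exact (hI.leaves.below 1 le_rfl (by omega)).1
    have hmin : ∀ q < n, τ.realArr keyA p ≤ τ.realArr keyA q := by
      intro q hq
      have := key_root_le hI.matches_ok (v := n + q) (by omega) (by omega)
      rwa [hI.leaves.leaf q hq, ← hpdef] at this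
    have hpbig : τ.realArr keyA p < big := by
      refine (hmin x hx.1).trans_lt ?_
      rw [hI.key_notMem x hx.1 hx.2, (hK x hx.1).2]
      exact Nat.pos_of_ne_zero hwx
    have hpR : p ∉ R := fun h => by
      rw [hI.key_mem p h] at hpbig
      exact lt_irrefl _ hpbig
    have hkp := hI.key_notMem p hpn hpR
    simp only [runs_seq, runs_setN, runs_setR, runs_putR, NExp.eval, RExp.eval, NExp.cost,
      RExp.cost, rowWeight]
    simp only [State.setN_nat, State.setN_natArr, State.setN_realArr, State.putR_nat,
      State.setN_real, State.setR_nat, State.setR_natArr, State.setR_real,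
      if_true, e₁, e₃, e₄, e₅, NVar.tmp.injEq,
      reduceCtorEq, if_false, ← hpdef]
    refine (runs_climb (n := n) (v := (n + p) / 2) (key := Function.update (τ.realArr keyA) p big)
      (by simp) (by simp) (by omega) (by simpa using hI.leaves) ?_).frame.mono ?_
    · intro u hu hu' hne
      simp only [State.setN_natArr, State.putR_natArr, State.setR_natArr]
      refine (hI.matches_ok u hu hu').update_key ?_ hpbig.le
      -- If the removed leaf won at `u`, then `u` lies above that leaf and is thus on the path about
      -- to be climbed. The exponent 0 is excluded because leaves have numbers at least `n`.
      rintro rfl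
      obtain ⟨-, i, hi'⟩ := hI.leaves.below u hu (by omega)
      cases i with
      | zero =>
        rw [pow_zero, Nat.div_one] at hi'
        omega
      | succ i =>
        rw [pow_succ', ← Nat.div_div_eq_div_mul] at hi'
        exact hne i hi'
    · rintro τ' t ⟨hF', ht, hl', hm'⟩
      have f₁ := hF'.nat takenV (by simp [climb, playMatch])
      have f₂ := hF'.real .z (by simp [climb, playMatch])
      have f₃ := hF'.realArr keyA (by simp [climb, playMatch])
      simp at f₁ f₂ f₃
      simp only [runs_skip]
      refine ⟨⟨insert p R, ⟨?_, ?_, ?_, ?_, hl', ?_, ?_, ?_⟩⟩, ?_⟩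
      · exact Finset.insert_subset (Finset.mem_range.2 hpn) hI.subset
      · rw [f₁, Finset.sum_insert hpR, hI.taken, add_comm]
      · intro q hq
        rw [f₃, Function.update_apply]
        split_ifs with hqp
        · rfl
        · exact hI.key_mem q ((Finset.mem_insert.1 hq).resolve_left hqp)
      · intro q hq hqR
        rw [Finset.mem_insert, not_or] at hqR
        rw [f₃, Function.update_of_ne hqR.1]
        exact hI.key_notMem q hq hqR.2
      · rw [f₃]
        exact hm'
      · intro q hq q' hq' hqR
        rw [Finset.mem_insert, not_or] at hqR
        rcases Finset.mem_insert.1 hq with rfl | hq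
        · rw [← hkp, ← hI.key_notMem q' hq' hqR.2]
          exact hmin q' hq'
        · exact hI.sorted q hq q' hq' hqR.2
      · intro _
        rw [f₂, hkp]
        -- The upper half is the complement of `R` before `p` is inserted; by the loop test it has
        -- more than half of the weight.
        refine ⟨⟨p, hpn, ?_, rfl⟩, ?_, Finset.range n \ R, Finset.sdiff_subset, by omega, ?_⟩
        · rw [← (hK p hpn).2, ← hkp]
          exact hpbig
        · intro q hq
          rcases Finset.mem_insert.1 hq with rfl | hq
          · exact le_rfl
          · exact hI.sorted q hq p hpn hpR
        · intro q hq
          rw [Finset.mem_sdiff, Finset.mem_range] at hq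
          rw [← hkp, ← hI.key_notMem q hq.1 hq.2]
          exact hmin q hq.1
      · have := Nat.mul_le_mul_left (40 * n.size + 60) (numRemaining_update hpn hpbig)
        rw [mul_add] at this
        rw [f₃]
        simp only [BExp.cost, NExp.cost]
        omega
  · rintro τ t ⟨hF, ⟨R, hI⟩, hp, ht⟩
    have e₂ := hF.nat activeV (by simp [climb, playMatch])
    simp [hA] at e₂
    simp only [BExp.Holds, NExp.eval, e₂, hI.taken] at hp
    have hp' : ∑ p ∈ Finset.range n, w p ≤ 2 * ∑ p ∈ R, w p := by
      rw [two_mul]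
      exact not_lt.1 hp
    have hR : R.Nonempty := by
      rw [Finset.nonempty_iff_ne_empty]
      rintro rfl
      rw [Finset.sum_empty] at hp'
      change 0 < ∑ p ∈ Finset.range n, w p at hApos
      omega
    obtain ⟨h₁, h₂, h₃⟩ := hI.pivot hR
    simp only [runs_skip]
    refine ⟨?_, h₁, ⟨R, hI.subset, hp', h₂⟩, h₃⟩
    have hcard : numRemaining n big (σ.realArr keyA) ≤ n := by
      classical
      exact (Finset.card_filter_le _ _).trans (Finset.card_range n).le
    have := Nat.mul_le_mul_left (40 * n.size + 60) hcard
    simp only [State.setN_realArr, BExp.cost, NExp.cost] at ht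
    omega

/-! ### Discarding candidates -/

/-- Rows holding at least half of the weight lose at least half of it, which is a quarter of the
total. -/
theorem four_mul_sum_le {n : ℕ} {w w' : ℕ → ℕ} {L : Finset ℕ} (hL : L ⊆ Finset.range n)
    (hle : ∀ p < n, w' p ≤ w p) (hhalf : ∀ p ∈ L, 0 < w p → 2 * w' p ≤ w p)
    (hsum : ∑ p ∈ Finset.range n, w p ≤ 2 * ∑ p ∈ L, w p) :
    4 * ∑ p ∈ Finset.range n, w' p ≤ 3 * ∑ p ∈ Finset.range n, w p := by
  have h₁ : ∑ p ∈ L, 2 * w' p ≤ ∑ p ∈ L, w p := Finset.sum_le_sum fun p hp => by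
    have h := hle p (Finset.mem_range.1 (hL hp))
    rcases Nat.eq_zero_or_pos (w p) with h0 | h0
    · omega
    · exact hhalf p hp h0
  have h₂ : ∑ p ∈ Finset.range n \ L, w' p ≤ ∑ p ∈ Finset.range n \ L, w p :=
    Finset.sum_le_sum fun p hp => hle p (Finset.mem_range.1 (Finset.sdiff_subset hp))
  rw [← Finset.mul_sum] at h₁
  have h₃ := Finset.sum_sdiff (f := w) hL
  have h₄ := Finset.sum_sdiff (f := w') hL
  omega

theorem card_filter_fin_le (n m : ℕ) :
    ((Finset.univ : Finset (Fin n)).filter (fun q : Fin n => m ≤ (q : ℕ))).card = n - m := by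
  rw [Finset.card_filter, Fin.sum_univ_eq_sum_range (fun q => if m ≤ q then 1 else 0),
    ← Finset.card_filter, ← Nat.card_Ico]
  congr 1
  ext q
  simp only [Finset.mem_filter, Finset.mem_range, Finset.mem_Ico]
  exact and_comm

section cuts

variable {a : ℕ → ℝ} {n : ℕ} {z : ℝ} {cut : ℕ → ℕ}

/-- The restriction `p < q` is automatic: a difference exceeding `z ≥ 0` is positive. So row `p`
contributes exactly the columns from `cut p` on. -/
theorem numAbove_eq_sum (ha : StrictMono (fun i : Fin n => a i)) (hz : 0 ≤ z)
    (hcut : ∀ p < n, ∀ q < n, (q < cut p ↔ a q ≤ a p + z)) :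
    numAbove (fun i : Fin n => a i) z = ∑ p ∈ Finset.range n, (n - cut p) := by
  classical
  rw [numAbove, Finset.card_filter, Fintype.sum_prod_type,
    ← Fin.sum_univ_eq_sum_range (fun p => n - cut p)]
  refine Finset.sum_congr rfl fun p _ => ?_
  rw [← Finset.card_filter, ← card_filter_fin_le]
  congr 1
  ext q
  simp only [Finset.mem_filter, Finset.mem_univ, true_and]
  rw [← not_lt, hcut p p.2 q q.2, not_le, lt_sub_iff_add_lt']
  refine ⟨fun h => h.2, fun h => ⟨?_, h⟩⟩
  rw [← ha.lt_iff_lt]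
  show a p < a q
  linarith

/-- Here `z > 0` is what rules out `q ≤ p`; for `z = 0` the diagonal would be counted. -/
theorem numAtLeast_eq_sum (ha : StrictMono (fun i : Fin n => a i)) (hz : 0 < z)
    (hcut : ∀ p < n, ∀ q < n, (q < cut p ↔ a q < a p + z)) :
    numAtLeast (fun i : Fin n => a i) z = ∑ p ∈ Finset.range n, (n - cut p) := by
  classical
  rw [numAtLeast, Finset.card_filter, Fintype.sum_prod_type,
    ← Fin.sum_univ_eq_sum_range (fun p => n - cut p)]
  refine Finset.sum_congr rfl fun p _ => ?_
  rw [← Finset.card_filter, ← card_filter_fin_le]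
  congr 1
  ext q
  simp only [Finset.mem_filter, Finset.mem_univ, true_and]
  rw [← not_lt (a := (q : ℕ)), hcut p p.2 q q.2, not_lt, le_sub_iff_add_le']
  refine ⟨fun h => h.2, fun h => ⟨?_, h⟩⟩
  rw [← ha.lt_iff_lt]
  show a p < a q
  linarith

/-- The three possible outcomes of a comparison of the pivot with the wanted rank `r`. -/
theorem runs_discard {σ : State} {r : ℕ} {lo hi : ℕ → ℕ}
    (ha : StrictMono (fun i : Fin n => a i)) (hz : 0 < z) (hn : σ.nat .n = n)
    (hσa : σ.realArr .alpha = a) (hσz : σ.real .z = z) (hr : σ.nat .rank = r)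
    (hlo : σ.natArr loA = lo) (hhi : σ.natArr hiA = hi) :
    Runs discard σ (fun σ' t => t ≤ 180 * n + 100 ∧
      ((r ≤ numAbove (fun i : Fin n => a i) z ∧ σ'.nat doneV = σ.nat doneV ∧
          σ'.natArr hiA = hi ∧ ∃ cut : ℕ → ℕ, ∀ p < n, σ'.natArr loA p = max (lo p) (cut p) ∧
            ∀ q < n, (q < cut p ↔ a q ≤ a p + z)) ∨
        (numAtLeast (fun i : Fin n => a i) z < r ∧ σ'.nat doneV = σ.nat doneV ∧
          σ'.natArr loA = lo ∧ ∃ cut : ℕ → ℕ, ∀ p < n, σ'.natArr hiA p = min (hi p) (cut p) ∧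
            ∀ q < n, (q < cut p ↔ a q < a p + z)) ∨
        (IsNthLongest (fun i : Fin n => a i) r z ∧ σ'.nat doneV = 1 ∧
          σ'.natArr loA = lo ∧ σ'.natArr hiA = hi))) := by
  rw [discard, runs_seq]
  refine (runs_scanRows (D := fun p q => a q ≤ a p + z) hn hσa hσz (by simp [atMostPivot])
    (fun τ h₁ h₂ => by simp [atMostPivot, h₁, h₂]) (fun p q hp h => ?_)).frame.mono ?_
  · have := le_of_strictMono ha (i := p) (j := p + 1) (by omega) hp
    linarith
  rintro τ t ⟨hF, ht, hcount, hcut⟩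
  -- The scan yields only the first failing column; since `a` increases, all later columns fail too.
  have hcut' : ∀ p < n, ∀ q < n, (q < τ.natArr cutA p ↔ a q ≤ a p + z) := by
    refine fun p hp q hq => ⟨(hcut p hp).2.1 q, fun h => ?_⟩
    by_contra hlt
    have h₁ := le_of_strictMono ha (not_lt.1 hlt) hq
    exact (hcut p hp).2.2 (by omega) (h₁.trans h)
  rw [← numAbove_eq_sum ha hz.le hcut'] at hcount
  have e₁ := hF.nat .n (by simp [scanRows])
  have e₂ := hF.nat .rank (by simp [scanRows])
  have e₃ := hF.nat doneV (by simp [scanRows])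
  have e₄ := hF.natArr loA (by simp [scanRows])
  have e₅ := hF.natArr hiA (by simp [scanRows])
  have e₆ := hF.realArr .alpha (by simp [scanRows])
  have e₇ := hF.real .z (by simp [scanRows])
  rw [hn] at e₁
  rw [hr] at e₂
  rw [hlo] at e₄
  rw [hhi] at e₅
  rw [hσa] at e₆
  rw [hσz] at e₇
  rw [runs_cond]
  simp only [BExp.Holds, NExp.eval, e₂, hcount, BExp.cost, NExp.cost]
  constructor
  · intro hle
    refine (runs_raiseLo e₁ e₄ rfl).frame.mono ?_
    rintro τ' t' ⟨hF', ht', hlo'⟩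
    have f₃ := hF'.nat doneV (by simp [raiseLo])
    have f₅ := hF'.natArr hiA (by simp [raiseLo])
    exact ⟨by omega, .inl ⟨hle, f₃.trans e₃, f₅.trans e₅, τ.natArr cutA,
      fun p hp => ⟨hlo' p hp, hcut' p hp⟩⟩⟩
  · intro hgt
    rw [runs_seq]
    refine (runs_scanRows (D := fun p q => a q < a p + z) e₁ e₆ e₇ (by simp [belowPivot])
      (fun τ h₁ h₂ => by simp [belowPivot, h₁, h₂]) (fun p q hp h => ?_)).frame.mono ?_
    · have := le_of_strictMono ha (i := p) (j := p + 1) (by omega) hp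
      linarith
    rintro ρ s ⟨hG, hs, hcnt, hc⟩
    have hc' : ∀ p < n, ∀ q < n, (q < ρ.natArr cutA p ↔ a q < a p + z) := by
      refine fun p hp q hq => ⟨(hc p hp).2.1 q, fun h => ?_⟩
      by_contra hlt
      have h₁ := le_of_strictMono ha (not_lt.1 hlt) hq
      exact (hc p hp).2.2 (by omega) (h₁.trans_lt h)
    rw [← numAtLeast_eq_sum ha hz hc'] at hcnt
    have g₁ := (hG.nat .n (by simp [scanRows])).trans e₁
    have g₂ := (hG.nat .rank (by simp [scanRows])).trans e₂
    have g₃ := (hG.nat doneV (by simp [scanRows])).trans e₃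
    have g₄ := (hG.natArr loA (by simp [scanRows])).trans e₄
    have g₅ := (hG.natArr hiA (by simp [scanRows])).trans e₅
    rw [runs_cond]
    simp only [BExp.Holds, NExp.eval, g₂, hcnt, BExp.cost, NExp.cost]
    constructor
    · intro hlt
      refine (runs_lowerHi g₁ g₅ rfl).frame.mono ?_
      rintro τ' t' ⟨hF', ht', hhi'⟩
      have f₃ := hF'.nat doneV (by simp [lowerHi])
      have f₄ := hF'.natArr loA (by simp [lowerHi])
      exact ⟨by omega, .inr (.inl ⟨hlt, f₃.trans g₃, f₄.trans g₄, ρ.natArr cutA,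
        fun p hp => ⟨hhi' p hp, hc' p hp⟩⟩)⟩
    · intro hge
      rw [runs_setN]
      refine ⟨by simp only [NExp.cost]; omega, .inr (.inr ⟨?_, ?_, ?_, ?_⟩)⟩
      · rw [isNthLongest_iff]
        omega
      · simp
      · simpa using g₄
      · simpa using g₅

end cuts

/-! ### Correctness of the selection program -/

/-- The candidates with the value `d` are active until the program is done. -/
structure SelectInv (a : ℕ → ℝ) (n : ℕ) (d : ℝ) (τ : State) : Prop where
  lt_lo : ∀ p < n, p < τ.natArr loA p
  hi_le : ∀ p < n, τ.natArr hiA p ≤ n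
  active : ∀ p q, p < q → q < n → a q - a p = d → τ.natArr loA p ≤ q ∧ q < τ.natArr hiA p
  done : τ.nat doneV = 0 ∨ τ.nat doneV = 1 ∧ τ.real .z = d

/-- The number of active candidates. -/
def numActive (n : ℕ) (τ : State) : ℕ :=
  ∑ p ∈ Finset.range n, (τ.natArr hiA p - τ.natArr loA p)

section select

variable {a : ℕ → ℝ} {n r : ℕ} {d : ℝ}

theorem SelectInv.numActive_pos {τ : State} (hI : SelectInv a n d τ)
    (hd : IsNthLongest (fun i : Fin n => a i) r d) : 0 < numActive n τ := by
  obtain ⟨p, q, hpq, hx⟩ := hd.exists_pair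
  have := hI.active p q hpq q.2 hx.symm
  exact Finset.sum_pos' (fun _ _ => Nat.zero_le _)
    ⟨p, Finset.mem_range.2 p.2, by omega⟩

/-- If at least `r` candidates exceed the pivot `z`, then `z < d` and all candidates `≤ z` may go.
If fewer than `r` are `≥ z`, then `d < z` and all candidates `≥ z` may go. Otherwise `z = d`. In the
first two cases the median property supplies rows with half of the weight that lose their middle and
everything on one side of it. -/
theorem runs_selectRound (ha : StrictMono (fun i : Fin n => a i))
    (hd : IsNthLongest (fun i : Fin n => a i) r d) {τ : State} (h1 : 1 ≤ n) (hn : τ.nat .n = n)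
    (hτa : τ.realArr .alpha = a) (hr : τ.nat .rank = r) (hI : SelectInv a n d τ)
    (hdone : τ.nat doneV = 0) :
    Runs (block [loadKeys, buildTree, findPivot, discard]) τ (fun τ' t =>
      t ≤ (40 * n.size + 400) * n + 180 ∧ SelectInv a n d τ' ∧
      (τ'.nat doneV = 1 ∨ τ'.nat doneV = 0 ∧ 4 * numActive n τ' ≤ 3 * numActive n τ)) := by
  have hpos := hI.numActive_pos hd
  simp only [block, List.foldr]
  rw [runs_seq]
  refine (runs_loadKeys hn hτa rfl rfl).frame.mono ?_
  rintro τ₁ t₁ ⟨hF₁, ht₁, hbig, hact, hleaf, hkey⟩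
  have b₁ := (hF₁.nat .n (by simp [loadKeys])).trans hn
  have b₂ := (hF₁.nat .rank (by simp [loadKeys])).trans hr
  have b₃ := (hF₁.nat doneV (by simp [loadKeys])).trans hdone
  have b₄ := hF₁.natArr loA (by simp [loadKeys])
  have b₅ := hF₁.natArr hiA (by simp [loadKeys])
  have b₆ := (hF₁.realArr .alpha (by simp [loadKeys])).trans hτa
  rw [runs_seq]
  refine (runs_buildTree b₁ h1 rfl hleaf).frame.mono ?_
  rintro τ₂ t₂ ⟨hF₂, ht₂, hleaves, hmatch⟩
  have c₁ := (hF₂.nat .n (by simp [buildTree, playMatch])).trans b₁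
  have c₂ := (hF₂.nat .rank (by simp [buildTree, playMatch])).trans b₂
  have c₃ := (hF₂.nat doneV (by simp [buildTree, playMatch])).trans b₃
  have c₄ := (hF₂.natArr loA (by simp [buildTree, playMatch])).trans b₄
  have c₅ := (hF₂.natArr hiA (by simp [buildTree, playMatch])).trans b₅
  have c₆ := (hF₂.realArr .alpha (by simp [buildTree, playMatch])).trans b₆
  have c₇ := hF₂.realArr keyA (by simp [buildTree, playMatch])
  have c₈ := (hF₂.real bigV (by simp [buildTree, playMatch])).trans hbig
  have c₉ := (hF₂.nat activeV (by simp [buildTree, playMatch])).trans hact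
  rw [← c₇] at hkey hmatch
  rw [runs_seq]
  refine (runs_findPivot c₁ h1 c₄ c₅ c₈ c₉ hpos hkey ?_ hleaves hmatch).frame.mono ?_
  · intro p hp
    have h₁ := hI.lt_lo p hp
    have h₂ := hI.hi_le p hp
    -- Every real key is at most `a (n - 1) - a 0`, so the key of an empty row, one larger, lies
    -- strictly above.
    unfold rowKey
    split_ifs with h
    · have h₃ := le_of_strictMono ha (i := 0) (j := p) (by omega) hp
      have h₄ := le_of_strictMono ha (i := (τ.natArr loA p + τ.natArr hiA p) / 2) (j := n - 1)
        (by omega) (by omega)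
      exact ⟨by linarith, fun _ => by omega, fun _ => by linarith⟩
    · exact ⟨le_rfl, fun h' => absurd h' (lt_irrefl _), fun h' => by omega⟩
  rintro τ₃ t₃ ⟨hF₃, ht₃, hmed⟩
  have d₁ := (hF₃.nat .n (by simp [findPivot, climb, playMatch])).trans c₁
  have d₂ := (hF₃.nat .rank (by simp [findPivot, climb, playMatch])).trans c₂
  have d₃ := (hF₃.nat doneV (by simp [findPivot, climb, playMatch])).trans c₃
  have d₄ := (hF₃.natArr loA (by simp [findPivot, climb, playMatch])).trans c₄
  have d₅ := (hF₃.natArr hiA (by simp [findPivot, climb, playMatch])).trans c₅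
  have d₆ := (hF₃.realArr .alpha (by simp [findPivot, climb, playMatch])).trans c₆
  generalize hz : τ₃.real .z = z at hmed
  have hkeyeq : ∀ p, 0 < τ.natArr hiA p - τ.natArr loA p →
      rowKey a (τ.natArr loA) (τ.natArr hiA) (a (n - 1) - a 0 + 1) p =
        a ((τ.natArr loA p + τ.natArr hiA p) / 2) - a p := fun p hp => by
    rw [rowKey, if_pos (by omega)]
  have hzpos : 0 < z := by
    obtain ⟨p, hp, hw, rfl⟩ := hmed.mem
    rw [hkeyeq p hw]
    have h₁ := hI.lt_lo p hp
    have h₂ := hI.hi_le p hp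
    have h₃ := ha (a := ⟨p, hp⟩) (b := ⟨(τ.natArr loA p + τ.natArr hiA p) / 2, by omega⟩)
      (Fin.lt_def.2 (show p < (τ.natArr loA p + τ.natArr hiA p) / 2 by omega))
    simp only at h₃
    linarith
  rw [runs_seq]
  refine (runs_discard ha hzpos d₁ d₆ hz d₂ d₄ d₅).frame.mono ?_
  rintro τ₄ t₄ ⟨hF₄, ht₄, hcase⟩
  have hz' := (hF₄.real .z (by simp [discard, scanRows, raiseLo, lowerHi])).trans hz
  rw [runs_skip]
  have hnum := isNthLongest_iff.1 hd
  have htime : (40 * n.size + 400) * n = (40 * n.size + 60) * n + 340 * n := by ring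
  refine ⟨by omega, ?_⟩
  rcases hcase with ⟨hrank, hdn, hhi, cut, hcut⟩ | ⟨hrank, hdn, hlo, cut, hcut⟩ |
    ⟨hnth, hdn, hlo, hhi⟩
  · have hdz : z < d := by
      by_contra h
      have := numAbove_anti (α := fun i : Fin n => a i) (not_lt.1 h)
      omega
    rw [d₃] at hdn
    refine ⟨⟨fun p hp => ?_, fun p hp => ?_, fun p q hpq hq hv => ?_, .inl hdn⟩, .inr ⟨hdn, ?_⟩⟩
    · have := hI.lt_lo p hp
      rw [(hcut p hp).1]
      omega
    · rw [hhi]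
      exact hI.hi_le p hp
    · have h₁ := hI.active p q hpq hq hv
      have h₂ : ¬ q < cut p := by
        rw [(hcut p (by omega)).2 q hq]
        intro h
        linarith
      rw [(hcut p (by omega)).1, hhi]
      omega
    · obtain ⟨R, hR, hsum, hle⟩ := hmed.lower
      refine four_mul_sum_le hR (fun p hp => ?_) (fun p hp hw => ?_) hsum
      · rw [(hcut p hp).1, hhi]
        omega
      · have hpn := Finset.mem_range.1 (hR hp)
        have h₁ := hle p hp
        rw [hkeyeq p hw] at h₁
        have h₂ := hI.hi_le p hpn
        -- The middle element is itself discarded, so at most `hi - mid - 1` candidates of the row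
        -- survive, no more than half.
        have h₃ := ((hcut p hpn).2 ((τ.natArr loA p + τ.natArr hiA p) / 2) (by omega)).2
          (by linarith)
        rw [(hcut p hpn).1, hhi]
        omega
  · have hdz : d < z := by
      by_contra h
      have := numAtLeast_anti (α := fun i : Fin n => a i) (not_lt.1 h)
      omega
    rw [d₃] at hdn
    refine ⟨⟨fun p hp => ?_, fun p hp => ?_, fun p q hpq hq hv => ?_, .inl hdn⟩, .inr ⟨hdn, ?_⟩⟩
    · rw [hlo]
      exact hI.lt_lo p hp
    · have := hI.hi_le p hp
      rw [(hcut p hp).1]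
      omega
    · have h₁ := hI.active p q hpq hq hv
      have h₂ : q < cut p := by
        rw [(hcut p (by omega)).2 q hq]
        linarith
      rw [(hcut p (by omega)).1, hlo]
      omega
    · obtain ⟨R, hR, hsum, hle⟩ := hmed.upper
      refine four_mul_sum_le hR (fun p hp => ?_) (fun p hp hw => ?_) hsum
      · rw [(hcut p hp).1, hlo]
        omega
      · have hpn := Finset.mem_range.1 (hR hp)
        have h₁ := hle p hp
        rw [hkeyeq p hw] at h₁
        have h₂ := hI.hi_le p hpn
        -- The cut is at or before the middle, so at most `mid - lo` candidates of the row survive;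
        -- rounding down keeps this within half.
        have h₃ : ¬ (τ.natArr loA p + τ.natArr hiA p) / 2 < cut p := by
          rw [(hcut p hpn).2 _ (by omega)]
          intro h
          linarith
        rw [(hcut p hpn).1, hlo]
        omega
  · refine ⟨⟨?_, ?_, ?_, .inr ⟨hdn, ?_⟩⟩, .inl hdn⟩
    · rw [hlo]
      exact hI.lt_lo
    · rw [hhi]
      exact hI.hi_le
    · rw [hlo, hhi]
      exact hI.active
    · rw [hz']
      exact le_antisymm (hd.anti hnth le_rfl) (hnth.anti hd le_rfl)

/-- One round leaves only the factor 3/4, but `(3/4)³ = 27/64 < 1/2`: the cube is more than halved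
and loses a bit. -/
theorem size_cube_add_one_le {A A' : ℕ} (hA : 0 < A) (h : 4 * A' ≤ 3 * A) :
    (A' ^ 3).size + 1 ≤ (A ^ 3).size := by
  refine size_add_one_le (Nat.one_le_pow _ _ hA) ?_
  have h₁ : (4 * A') ^ 3 ≤ (3 * A) ^ 3 := Nat.pow_le_pow_left h 3
  rw [mul_pow, mul_pow] at h₁
  omega

theorem size_cube_sq_le (n : ℕ) : ((n * n) ^ 3).size ≤ 6 * n.size := by
  rw [Nat.size_le]
  calc (n * n) ^ 3 = n ^ 6 := by ring
    _ < (2 ^ n.size) ^ 6 := Nat.pow_lt_pow_left (Nat.lt_size_self n) (by norm_num)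
    _ = 2 ^ (6 * n.size) := by rw [← pow_mul, mul_comm]

theorem runs_selectPath (ha : StrictMono (fun i : Fin n => a i)) (h1 : 1 ≤ n)
    (hr₁ : 1 ≤ r) (hr₂ : r ≤ n.choose 2) {σ : State} (hn : σ.nat .n = n)
    (hσa : σ.realArr .alpha = a) (hr : σ.nat .rank = r) :
    Runs selectPath σ (fun σ' t =>
      t ≤ ((40 * n.size + 400) * n + 200) * (6 * n.size) + 20 * n + 30 ∧
      IsNthLongest (fun i : Fin n => a i) r (σ'.real .z)) := by
  obtain ⟨d, hd⟩ := exists_isNthLongest (α := fun i : Fin n => a i) hr₁ hr₂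
  simp only [selectPath, block, List.foldr]
  rw [runs_seq]
  refine (runs_initRows hn).frame.mono ?_
  rintro τ₀ t₀ ⟨hF₀, ht₀, hrows⟩
  have c₁ := (hF₀.nat .n (by simp [initRows])).trans hn
  have c₂ := (hF₀.nat .rank (by simp [initRows])).trans hr
  have c₃ := (hF₀.realArr .alpha (by simp [initRows])).trans hσa
  simp only [runs_seq, runs_setN, NExp.eval, NExp.cost]
  -- The potential vanishes once the program is done. Before that the wanted candidate is active, so
  -- `numActive` is positive and the bit length is at least one, which pays for the last round.
  refine (runs_loop_frame _ (SelectInv a n d)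
    (fun τ => ((40 * n.size + 400) * n + 200) *
      (if τ.nat doneV = 0 then (numActive n τ ^ 3).size else 0)) ?_ ?_).mono ?_
  · refine ⟨?_, ?_, ?_, ?_⟩ <;> simp only [State.setN_natArr, State.setN_nat, if_true, true_or]
    · intro p hp
      rw [(hrows p hp).1]
      omega
    · intro p hp
      rw [(hrows p hp).2]
    · intro p q hpq hq _
      rw [(hrows p (by omega)).1, (hrows p (by omega)).2]
      omega
  · intro τ hF hI hp
    have e₁ := hF.nat .n (by
      simp [loadKeys, buildTree, findPivot, discard, climb, playMatch, scanRows, raiseLo, lowerHi])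
    have e₂ := hF.nat .rank (by
      simp [loadKeys, buildTree, findPivot, discard, climb, playMatch, scanRows, raiseLo, lowerHi])
    have e₃ := hF.realArr .alpha (by
      simp [loadKeys, buildTree, findPivot, discard, climb, playMatch, scanRows, raiseLo, lowerHi])
    simp [c₁, c₂, c₃] at e₁ e₂ e₃
    have hdone : τ.nat doneV = 0 := by
      simp only [BExp.Holds, NExp.eval] at hp
      omega
    refine (runs_selectRound ha hd h1 e₁ e₃ e₂ hI hdone).mono ?_
    rintro τ' t ⟨ht, hI', hcase⟩
    refine ⟨hI', ?_⟩
    have hpos := hI.numActive_pos hd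
    have hs : (if τ'.nat doneV = 0 then (numActive n τ' ^ 3).size else 0) + 1 ≤
        (numActive n τ ^ 3).size := by
      rcases hcase with h | ⟨h, hA⟩
      · rw [if_neg (by omega)]
        exact Nat.size_pos.2 (by positivity)
      · rw [if_pos h]
        exact size_cube_add_one_le hpos hA
    have hm := Nat.mul_le_mul_left ((40 * n.size + 400) * n + 200) hs
    rw [mul_add] at hm
    rw [if_pos hdone]
    simp only [BExp.cost, NExp.cost]
    omega
  · rintro τ t ⟨-, hI, hp, ht⟩
    simp only [BExp.Holds, NExp.eval] at hp
    have hzd : τ.real .z = d := by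
      rcases hI.done with h | h
      · omega
      · exact h.2
    rw [runs_skip, hzd]
    refine ⟨?_, hd⟩
    have hA : numActive n (τ₀.setN doneV 0) ≤ n * n := by
      have : ∀ p ∈ Finset.range n, (τ₀.setN doneV 0).natArr hiA p -
          (τ₀.setN doneV 0).natArr loA p ≤ n := by
        intro p hp
        have := (hrows p (Finset.mem_range.1 hp)).2
        simp only [State.setN_natArr]
        omega
      simpa [numActive] using Finset.sum_le_card_nsmul _ _ _ this
    have hs := (Nat.size_le_size (Nat.pow_le_pow_left hA 3)).trans (size_cube_sq_le n)
    have hm := Nat.mul_le_mul_left ((40 * n.size + 400) * n + 200) hs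
    simp only [State.setN_nat, if_true, BExp.cost, NExp.cost] at ht
    omega

end select

theorem selectPath_agreesOffScratch {σ σ' : State} (h : Frame selectPath σ σ') :
    σ.AgreesOffScratch σ' := by
  refine ⟨fun x hx => h.nat x ?_, fun x hz hx => h.real x ?_, fun x hx => h.natArr x ?_,
    fun x hx => h.realArr x ?_⟩
  · have hx' : ∀ i, NVar.tmp i ≠ x := fun i hi => hx i hi.symm
    simp [selectPath, initRows, loadKeys, buildTree, findPivot, discard, climb, playMatch,
      scanRows, raiseLo, lowerHi, hx']
  · have hx' : ∀ i, RVar.tmp i ≠ x := fun i hi => hx i hi.symm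
    simp [selectPath, initRows, loadKeys, buildTree, findPivot, discard, climb, playMatch,
      scanRows, raiseLo, lowerHi, hx', hz.symm]
  · have hx' : ∀ i, NArr.tmp i ≠ x := fun i hi => hx i hi.symm
    simp [selectPath, initRows, loadKeys, buildTree, findPivot, discard, climb, playMatch,
      scanRows, raiseLo, lowerHi, hx']
  · have hx' : ∀ i, RArr.tmp i ≠ x := fun i hi => hx i hi.symm
    simp [selectPath, initRows, loadKeys, buildTree, findPivot, discard, climb, playMatch,
      scanRows, raiseLo, lowerHi, hx']

theorem isPathSelector_selectPath : IsPathSelector selectPath := by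
  -- The rounds contribute `1360 * 24 = 32640`: by `size n ≤ 4 * log n` and `1 ≤ 2 * log n` a round
  -- costs at most `1360 * n * log n`, and there are at most `6 * size n ≤ 24 * log n` rounds. The
  -- remaining `20 * n + 30 ≤ 50 * n` adds 200.
  refine ⟨33000, fun n α r σ hn2 hα hr₁ hr₂ hσ hr => ?_⟩
  obtain ⟨hn, hα'⟩ := hσ
  obtain rfl : α = fun i : Fin n => σ.realArr .alpha i := funext fun i => (hα' i).symm
  obtain ⟨σ', t, he, ht, hz⟩ := runs_selectPath hα (by omega) hr₁ hr₂ hn rfl hr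
  refine ⟨σ', t, he, ?_, hz, selectPath_agreesOffScratch he.frame⟩
  set s := n.size
  set l := Real.log n
  have hl : 1 / 2 ≤ l := half_le_log hn2
  have hs : (s : ℝ) ≤ 4 * l := size_le_log hn2
  have hn1 : (1 : ℝ) ≤ n := by exact_mod_cast (by omega : 1 ≤ n)
  have ht' : (t : ℝ) ≤ ((40 * s + 400) * n + 200) * (6 * s) + 20 * n + 30 := by exact_mod_cast ht
  have h₁ : ((40 * s + 400) * n + 200 : ℝ) ≤ 1360 * l * n := by nlinarith
  have h₂ : ((40 * s + 400) * n + 200 : ℝ) * (6 * s) ≤ 1360 * l * n * (24 * l) :=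
    mul_le_mul h₁ (by linarith) (by positivity) (by positivity)
  have h₃ : (50 * n : ℝ) ≤ 200 * (n * l ^ 2) := by
    have : 1 / 4 ≤ l ^ 2 := by nlinarith
    nlinarith
  have h₄ : 1360 * l * n * (24 * l) = 32640 * (n * l ^ 2) := by ring
  have h₅ : 0 ≤ (n : ℝ) * l ^ 2 := by positivity
  rw [mul_assoc]
  linarith

end RangeClustering

theorem mainTheorem4 :
    -- some optimal `k`-partition consists of consecutive blocks
    (∀ (n k : ℕ) (α : Fin n → ℝ), StrictMono α → 1 ≤ k → k ≤ n →
      ∃ P : RangeClustering.KPartition n k, P.IsOptimal α ∧ P.IsConsecutive) ∧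
    -- the greedy scan decides feasibility of a value `z` in `O(n)` steps
    (∃ C : ℝ, ∀ (n k : ℕ) (α : Fin n → ℝ) (z : ℝ) (σ : RangeClustering.State),
      StrictMono α → 1 ≤ k → k ≤ n → 0 ≤ z →
      σ.HasScalars α → σ.nat .k = k → σ.real .z = z →
      ∃ (σ' : RangeClustering.State) (t : ℕ),
        RangeClustering.Exec RangeClustering.feasibilityCheck σ σ' t ∧ (t : ℝ) ≤ C * n ∧
        (σ'.nat .ok = 0 ∨ σ'.nat .ok = 1) ∧
        (σ'.nat .ok = 1 ↔ ∃ P : RangeClustering.KPartition n k, P.maxRange α ≤ z)) ∧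
    -- a selection subroutine with `O(n log² n)` steps exists
    (∃ M : RangeClustering.Cmd, RangeClustering.IsPathSelector M) ∧
    -- with any such subroutine, the algorithm solves min max `k` range in `O(n log³ n)` steps
    (∀ M : RangeClustering.Cmd, RangeClustering.IsPathSelector M →
      ∃ C : ℝ, ∀ (n k : ℕ) (α : Fin n → ℝ) (σ : RangeClustering.State),
        StrictMono α → 1 ≤ k → k < n →
        σ.HasScalars α → σ.nat .k = k →
        ∃ (σ' : RangeClustering.State) (t : ℕ),
          RangeClustering.Exec (RangeClustering.minMaxKRange M) σ σ' t ∧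
          (t : ℝ) ≤ C * n * Real.log n ^ 3 ∧
          ∃ P : RangeClustering.KPartition n k, P.IsOptimal α ∧ P.IsConsecutive ∧
            (∀ (j : Fin k) (i : Fin n), i ∈ P.S j ↔ σ'.natArr .label i = j) ∧
            σ'.real .z = P.maxRange α) := by
  exact ⟨fun _ _ _ hα hk hkn => RangeClustering.exists_optimal_consecutive hα hk hkn,
    RangeClustering.exists_feasibilityCheck_bound,
    ⟨_, RangeClustering.isPathSelector_selectPath⟩,
    fun _ hM => RangeClustering.exists_minMaxKRange_bound hM⟩
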